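/- For $|q|<1$ let $(a;q)_n=\prod_{k=0}^{n-1}(1-aq^k)$, $$G(q)=\sum_{n\ge 0}\frac{q^{n^2}}{(q;q)_n},\qquad H(q)=\sum_{n\ge 0}\frac{q^{n(n+1)}}{(q;q)_n},$$ and for $|ab|<1$ let $f(a,b)=\sum_{n=-\infty}^{\infty}a^{n(n+1)/2}b^{n(n-1)/2}$, with $\varphi(q)=f(q,q)$, $\psi(q)=f(q,q^3)$ and $E(q)=f(-q,-q^2)$. For positive integers $r,s$ put $$U(r,s,q)=\begin{cases}G(q^r)G(q^s)+q^{(s+r)/5}H(q^r)H(q^s), & s+r\equiv 0 \pmod 5,\\ H(q^r)G(q^s)-q^{(s-r)/5}G(q^r)H(q^s), & s-r\equiv 0\pmod 5,\end{cases}$$ and write $U(r,s)=U(r,s,q)$. For a positive definite integral binary quadratic form $an^2+bnm+cm^2$ denote by $(a,b,c)$ its theta series $\sum_{n,m=-\infty}^{\infty}q^{an^2+bnm+cm^2}$. **Theorem.** Let $q$ be a complex number with $|q|<1$ and put $Q=q^{13}$. Then $$2q^2E(q^2)E(Q^6)\,U(1,39)\,U(1,39,-q)=(1,1,10)+(2,1,5)-(1,0,39)-(5,2,8),$$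 $$2q^2E(q^6)E(Q^2)\,U(3,13)\,U(3,13,-q)=(3,0,13)+(2,1,5)-(3,3,4)-(5,2,8).$$ Moreover, whenever the denominator on the left-hand side is non-zero, $$\frac{(3,0,13)-(5,2,8)}{(1,0,39)+(5,2,8)}=q^3\,\frac{\psi(-q)\psi(-Q^3)}{\psi(-q^3)\psi(-Q)},$$ $$\frac{(1,1,10)+(2,1,5)-(1,0,39)-(5,2,8)}{(3,0,13)+(2,1,5)-(3,3,4)-(5,2,8)}=\frac{\varphi(-q^6)\varphi(-Q^2)}{\varphi(-q^2)\varphi(-Q^6)}.$$ Here the denominators on the right-hand sides vanish for no $q$ with $|q|<1$, and the denominators on the left-hand sides are non-zero for all $q\ne 0$ sufficiently close to $0$. -/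

import Mathlib

open scoped Topology

noncomputable section

namespace RogersRamanujanForms

/-- The finite `q`-shifted factorial `(a; q)_n = ∏_{k=0}^{n-1} (1 - a q^k)`. -/
def qFactorial (a q : ℂ) (n : ℕ) : ℂ :=
  ∏ k ∈ Finset.range n, (1 - a * q ^ k)

/-- The Rogers--Ramanujan function `G(q) = ∑_{n ≥ 0} q^{n^2} / (q; q)_n`. -/
def G (q : ℂ) : ℂ :=
  ∑' n : ℕ, q ^ (n ^ 2) / qFactorial q q n

/-- The Rogers--Ramanujan function `H(q) = ∑_{n ≥ 0} q^{n(n+1)} / (q; q)_n`. -/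
def H (q : ℂ) : ℂ :=
  ∑' n : ℕ, q ^ (n * (n + 1)) / qFactorial q q n

/-- `U(r, s, q)`: equal to `G(q^r) G(q^s) + q^{(s+r)/5} H(q^r) H(q^s)` if `5 ∣ s + r`, and to
`H(q^r) G(q^s) - q^{(s-r)/5} G(q^r) H(q^s)` if `5 ∣ s - r`. The divisions are exact, and the
second exponent is an integer that may be negative. -/
def U (r s : ℕ) (q : ℂ) : ℂ :=
  if s + r ≡ 0 [MOD 5] then
    G (q ^ r) * G (q ^ s) + q ^ ((s + r) / 5) * H (q ^ r) * H (q ^ s)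
  else if (s : ℤ) - (r : ℤ) ≡ 0 [ZMOD 5] then
    H (q ^ r) * G (q ^ s) - q ^ (((s : ℤ) - (r : ℤ)) / 5) * G (q ^ r) * H (q ^ s)
  else 0

/-- Ramanujan's general theta function
`f(a, b) = ∑_{n ∈ ℤ} a^{n(n+1)/2} b^{n(n-1)/2}`, `|ab| < 1`. Both exponents are non-negative
integers (the divisions by `2` are exact). -/
def f (a b : ℂ) : ℂ :=
  ∑' n : ℤ, a ^ (n * (n + 1) / 2) * b ^ (n * (n - 1) / 2)

/-- `φ(q) = f(q, q) = ∑_{n ∈ ℤ} q^{n^2}`. -/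
def phi (q : ℂ) : ℂ := f q q

/-- `ψ(q) = f(q, q^3) = ∑_{n ≥ 0} q^{n(n+1)/2}`. -/
def psi (q : ℂ) : ℂ := f q (q ^ 3)

/-- `E(q) = f(-q, -q^2) = (q; q)_∞`. -/
def E (q : ℂ) : ℂ := f (-q) (-q ^ 2)

/-- The theta series `∑_{n, m ∈ ℤ} q^{a n^2 + b n m + c m^2}` of the positive definite binary
quadratic form `(a, b, c)`. -/
def form (a b c : ℤ) (q : ℂ) : ℂ :=
  ∑' p : ℤ × ℤ, q ^ (a * p.1 ^ 2 + b * p.1 * p.2 + c * p.2 ^ 2)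

end RogersRamanujanForms

end

/-!
For `q = 0` every assertion is immediate, so let `0 < |q| < 1`. By the Rogers--Ramanujan identities
`E(q) G(q)` and `E(q) H(q)` are the theta series `g(q) = f(-q^2, -q^3)` and `h(q) = f(-q, -q^4)`
(`thetaG`, `thetaH`). They are derived, together with the Jacobi triple product `f_eq_qProd`, from
Euler's expansion of an infinite product and the Durfee rectangle identity `durfee_eq`.

The products `E(q^2) G(q) G(-q)`, `E(q^2) G(q) H(-q)`, `E(q^2) G(q) G(q^4)`, `E(q^2) G(q) H(q^4)` and
their companions with `G` and `H` interchanged are linear combinations of one-dimensional theta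
series (`E_mul_G_mul_G_neg` and the lemmas after it). Most of these evaluations are comparisons of
infinite products. The mixed products at `q` and `-q` also use the addition formula `f_mul_f`. For
`G(q) G(q^4)` and `q H(q) H(q^4)` the sum and the product of the two terms are found, which
determines their difference up to a sign (`thetaG_mul_sub_thetaH_mul`).

Consequently, when `U(r, s, q) U(r, s, -q)` or `U(r, s, q) U(r, s, q^4)` is multiplied out and
multiplied by two values of `E`, it becomes a sum of products of two one-dimensional theta series.
That sum runs over the points `(x, y)` of a sublattice of `ℤ^2` given by a congruence modulo `5`,
with exponent proportional to `x^2 + 39 y^2` or `3 x^2 + 13 y^2`; in suitable coordinates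
(`tsum_rotate`) the exponent is one of the forms of discriminant `-39` or `-156`. The products at
`q` and `-q` give the first two identities. The products at `q` and `q^4` give
`2 E(q^2) E(Q^6) U(1, 39, q) U(1, 39, q^4) = (1,0,39) + (5,2,8)` and
`2 q^3 E(q^6) E(Q^2) U(3, 13, q) U(3, 13, q^4) = (3,0,13) - (5,2,8)`.

The same coordinates with signs show `E(q) E(Q^3) U(1, 39) = E(q^3) E(Q) U(3, 13)` (`E_mul_U_eq`).
Both quotient formulas follow by division, since `ψ(-q) E(q^2) = E(q) E(q^4)` and
`φ(-q^2) E(q^2) = E(q) E(-q)`. The two denominators do not vanish near `0` because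
`E(q) E(Q^3) U(1, 39, q)` is continuous with value `1` at `0`.
-/

namespace RogersRamanujanForms

open Filter

/-! ### Triangular exponents and summability -/

/-- The triangular number `n (n - 1) / 2`, as an integer; the division is exact. -/
def tri (n : ℤ) : ℤ := n * (n - 1) / 2

lemma two_mul_tri (n : ℤ) : 2 * tri n = n ^ 2 - n := by
  have h : (2 : ℤ) ∣ n * (n - 1) := by
    rcases Int.even_or_odd n with ⟨k, rfl⟩ | ⟨k, rfl⟩
    · exact ⟨k * (k + k - 1), by ring⟩
    · exact ⟨(2 * k + 1) * k, by ring⟩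
  rw [tri, Int.mul_ediv_cancel' h]
  ring

lemma tri_neg (n : ℤ) : tri (-n) = tri n + n := by
  have h₁ := two_mul_tri n
  have h₂ := two_mul_tri (-n)
  linarith

lemma tri_add_one (n : ℤ) : tri (n + 1) = tri n + n := by
  have h₁ := two_mul_tri n
  have h₂ := two_mul_tri (n + 1)
  linarith

lemma mul_add_one_div_two (n : ℤ) : n * (n + 1) / 2 = tri n + n := by
  rw [← tri_add_one, tri, add_sub_cancel_right, mul_comm]

lemma summable_norm_zpow_tri_nat {z q : ℂ} (hz : z ≠ 0) (hq0 : q ≠ 0) (hq : ‖q‖ < 1) :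
    Summable fun n : ℕ => ‖z ^ (n : ℤ) * q ^ tri n‖ := by
  refine summable_of_ratio_test_tendsto_lt_one (l := 0) zero_lt_one ?_ ?_
  · exact Eventually.of_forall fun n =>
      norm_ne_zero_iff.2 (mul_ne_zero (zpow_ne_zero _ hz) (zpow_ne_zero _ hq0))
  · have h : ∀ n : ℕ, ‖‖z ^ ((n + 1 : ℕ) : ℤ) * q ^ tri ((n + 1 : ℕ) : ℤ)‖‖ /
        ‖‖z ^ (n : ℤ) * q ^ tri n‖‖ = ‖z‖ * ‖q‖ ^ n := by
      intro n
      have h₁ : ‖z‖ ≠ 0 := norm_ne_zero_iff.2 hz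
      have h₂ : ‖q‖ ≠ 0 := norm_ne_zero_iff.2 hq0
      push_cast
      rw [tri_add_one, zpow_add₀ hz, zpow_add₀ hq0]
      simp only [norm_norm, norm_mul, norm_zpow, norm_pow, zpow_natCast, zpow_one]
      have h₃ : ‖q‖ ^ tri n ≠ 0 := zpow_ne_zero _ h₂
      field_simp
    simp only [h]
    simpa using (tendsto_pow_atTop_nhds_zero_of_lt_one (norm_nonneg q) hq).const_mul ‖z‖

lemma summable_norm_zpow_tri {z q : ℂ} (hz : z ≠ 0) (hq0 : q ≠ 0) (hq : ‖q‖ < 1) :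
    Summable fun n : ℤ => ‖z ^ n * q ^ tri n‖ := by
  refine Summable.of_nat_of_neg (summable_norm_zpow_tri_nat hz hq0 hq) ?_
  refine (summable_norm_zpow_tri_nat (z := q / z) (div_ne_zero hq0 hz) hq0 hq).congr fun n => ?_
  rw [tri_neg, zpow_add₀ hq0, div_zpow, zpow_neg]
  congr 1
  ring

/-- Summability of `s ^ n q ^ (A n (n - 1) / 2 + B n)` for `A > 0`. -/
lemma summable_norm_quadratic {s q : ℂ} (hs : s ≠ 0) (hq0 : q ≠ 0) (hq : ‖q‖ < 1) {A : ℕ}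
    (hA : A ≠ 0) (B : ℤ) : Summable fun n : ℤ => ‖s ^ n * q ^ (A * tri n + B * n)‖ := by
  have h := summable_norm_zpow_tri (z := s * q ^ B) (q := q ^ A)
    (mul_ne_zero hs (zpow_ne_zero _ hq0)) (pow_ne_zero _ hq0)
    (by rw [norm_pow]; exact pow_lt_one₀ (norm_nonneg q) hq hA)
  refine h.congr fun n => ?_
  rw [zpow_add₀ hq0, mul_zpow, zpow_mul, zpow_mul, zpow_natCast]
  congr 1
  ring

/-! ### Infinite products -/

/-- The infinite product `(a; q)_∞ = ∏_{k ≥ 0} (1 - a q^k)`. -/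
noncomputable def qProd (a q : ℂ) : ℂ := ∏' k : ℕ, (1 - a * q ^ k)

lemma summable_norm_mul_pow (a : ℂ) {q : ℂ} (hq : ‖q‖ < 1) :
    Summable fun k : ℕ => ‖-(a * q ^ k)‖ := by
  simp only [norm_neg, norm_mul, norm_pow]
  exact (summable_geometric_of_lt_one (norm_nonneg q) hq).mul_left _

lemma multipliable_one_sub_mul_pow (a : ℂ) {q : ℂ} (hq : ‖q‖ < 1) :
    Multipliable fun k : ℕ => 1 - a * q ^ k := by
  simpa only [sub_eq_add_neg] using multipliable_one_add_of_summable (summable_norm_mul_pow a hq)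

lemma tendsto_qFactorial (a : ℂ) {q : ℂ} (hq : ‖q‖ < 1) :
    Tendsto (qFactorial a q) atTop (𝓝 (qProd a q)) :=
  (multipliable_one_sub_mul_pow a hq).hasProd.tendsto_prod_nat

lemma one_sub_mul_pow_ne_zero {a q : ℂ} (ha : ‖a‖ < 1) (hq : ‖q‖ < 1) (k : ℕ) :
    1 - a * q ^ k ≠ 0 := by
  intro h
  have h₁ : ‖a * q ^ k‖ = 1 := by rw [← sub_eq_zero.1 h, norm_one]
  rw [norm_mul, norm_pow] at h₁
  have h₂ : ‖q‖ ^ k ≤ 1 := pow_le_one₀ (norm_nonneg q) hq.le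
  nlinarith [norm_nonneg a]

lemma qProd_ne_zero {a q : ℂ} (ha : ‖a‖ < 1) (hq : ‖q‖ < 1) : qProd a q ≠ 0 := by
  have h := tprod_one_add_ne_zero_of_summable (f := fun k : ℕ => -(a * q ^ k))
    (fun k => by simpa only [← sub_eq_add_neg] using one_sub_mul_pow_ne_zero ha hq k)
    (summable_norm_mul_pow a hq)
  simp only [← sub_eq_add_neg] at h
  exact h

lemma qFactorial_ne_zero {a q : ℂ} (ha : ‖a‖ < 1) (hq : ‖q‖ < 1) (n : ℕ) :
    qFactorial a q n ≠ 0 :=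
  Finset.prod_ne_zero_iff.2 fun k _ => one_sub_mul_pow_ne_zero ha hq k

lemma qProd_mul_qProd_neg (a : ℂ) {q : ℂ} (hq : ‖q‖ < 1) :
    qProd a q * qProd (-a) q = qProd (a ^ 2) (q ^ 2) := by
  rw [qProd, qProd, qProd, ← (multipliable_one_sub_mul_pow a hq).tprod_mul
    (multipliable_one_sub_mul_pow (-a) hq)]
  exact tprod_congr fun k => by ring

/-- Splitting of `(a; q)_∞` according to the residue of the index modulo `n`. -/
lemma qProd_eq_prod (a : ℂ) {q : ℂ} (hq : ‖q‖ < 1) {n : ℕ} (hn : n ≠ 0) :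
    qProd a q = ∏ i ∈ Finset.range n, qProd (a * q ^ i) (q ^ n) := by
  have hqn : ‖q ^ n‖ < 1 := by rw [norm_pow]; exact pow_lt_one₀ (norm_nonneg q) hq hn
  have h₁ : Tendsto (fun M : ℕ => qFactorial a q (M * n)) atTop (𝓝 (qProd a q)) :=
    (tendsto_qFactorial a hq).comp (tendsto_id.atTop_mul_const' (Nat.pos_of_ne_zero hn))
  have h₂ : Tendsto (fun M : ℕ => ∏ i ∈ Finset.range n, qFactorial (a * q ^ i) (q ^ n) M) atTop
      (𝓝 (∏ i ∈ Finset.range n, qProd (a * q ^ i) (q ^ n))) :=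
    tendsto_finsetProd _ fun i _ => tendsto_qFactorial _ hqn
  refine tendsto_nhds_unique h₁ (h₂.congr fun M => ?_)
  induction M with
  | zero => simp [qFactorial]
  | succ M ih =>
    rw [Nat.succ_mul]
    simp only [qFactorial] at ih ⊢
    rw [Finset.prod_range_add, ← ih, ← Finset.prod_mul_distrib]
    refine Finset.prod_congr rfl fun i _ => ?_
    rw [Finset.prod_range_succ]
    ring

/-! ### Reciprocals of `(q; q)_k` -/

/-- The reciprocal `1 / (q; q)_k` for an integer `k`, with the usual convention that it vanishes
for negative `k`. -/
noncomputable def qInv (q : ℂ) (k : ℤ) : ℂ := if k < 0 then 0 else (qFactorial q q k.toNat)⁻¹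

lemma qInv_natCast (q : ℂ) (n : ℕ) : qInv q n = (qFactorial q q n)⁻¹ := by simp [qInv]

lemma qInv_of_neg (q : ℂ) {k : ℤ} (hk : k < 0) : qInv q k = 0 := by simp [qInv, hk]

lemma qInv_zero (q : ℂ) : qInv q 0 = 1 := by simp [qInv, qFactorial]

/-- The recurrence `(1 - q ^ k) / (q; q)_k = 1 / (q; q)_{k-1}`, valid for all integers `k`. -/
lemma qInv_sub_one {q : ℂ} (hq : ‖q‖ < 1) (k : ℤ) : qInv q (k - 1) = (1 - q ^ k) * qInv q k := by
  rcases lt_trichotomy k 0 with hk | rfl | hk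
  · rw [qInv_of_neg q hk, qInv_of_neg q (by linarith), mul_zero]
  · simp [qInv_of_neg]
  · obtain ⟨n, rfl⟩ : ∃ n : ℕ, k = (n + 1 : ℕ) := ⟨(k - 1).toNat, by omega⟩
    have h : ((n + 1 : ℕ) : ℤ) - 1 = (n : ℕ) := by push_cast; ring
    rw [h, qInv_natCast, qInv_natCast, zpow_natCast]
    have h₁ := one_sub_mul_pow_ne_zero hq hq n
    have h₂ := qFactorial_ne_zero hq hq n
    have h₃ : qFactorial q q (n + 1) = qFactorial q q n * (1 - q * q ^ n) :=
      Finset.prod_range_succ _ _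
    rw [h₃, pow_succ']
    field_simp

lemma tendsto_qInv {q : ℂ} (hq : ‖q‖ < 1) :
    Tendsto (fun n : ℕ => qInv q n) atTop (𝓝 (qProd q q)⁻¹) := by
  simp only [qInv_natCast]
  exact (tendsto_qFactorial q hq).inv₀ (qProd_ne_zero hq hq)

lemma exists_norm_qInv_le {q : ℂ} (hq : ‖q‖ < 1) : ∃ C : ℝ, 0 ≤ C ∧ ∀ k : ℤ, ‖qInv q k‖ ≤ C := by
  obtain ⟨C, hC⟩ := (tendsto_qInv hq).norm.bddAbove_range
  have hC' : ∀ n : ℕ, ‖qInv q n‖ ≤ C := fun n => hC ⟨n, rfl⟩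
  refine ⟨C, (norm_nonneg _).trans (hC' 0), fun k => ?_⟩
  rcases lt_or_ge k 0 with hk | hk
  · rw [qInv_of_neg q hk, norm_zero]
    exact (norm_nonneg _).trans (hC' 0)
  · lift k to ℕ using hk
    exact hC' k

/-- A series over `ℤ` with factor `1 / (q; q)_n` is a series over the natural numbers. -/
lemma tsum_mul_qInv (q : ℂ) (c : ℤ → ℂ) :
    ∑' n : ℤ, c n * qInv q n = ∑' n : ℕ, c n / qFactorial q q n := by
  rw [← Function.Injective.tsum_eq (g := fun n : ℕ => (n : ℤ)) Nat.cast_injective]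
  · exact tsum_congr fun n => by rw [qInv_natCast, div_eq_mul_inv]
  · intro k hk
    have : ¬ k < 0 := fun h => hk (by simp [qInv_of_neg q h])
    exact ⟨k.toNat, by simp; omega⟩

lemma summable_norm_mul_of_le {ι : Type*} {u c : ι → ℂ} (hu : Summable fun i => ‖u i‖) {C : ℝ}
    (hc : ∀ i, ‖c i‖ ≤ C) : Summable fun i => ‖u i * c i‖ := by
  refine Summable.of_nonneg_of_le (fun i => norm_nonneg _) (fun i => ?_) (hu.mul_right C)
  rw [norm_mul]
  exact mul_le_mul_of_nonneg_left (hc i) (norm_nonneg _)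

/-! ### Euler's expansion and the Durfee rectangle identity -/

/-- Euler's expansion `∑ z^n q^{n(n-1)/2} / (q; q)_n = (-z; q)_∞`. The sum `F(z)` satisfies
`F(z) = (1 + z) F(z q)`, and `F(z q^n) → 1`. -/
lemma tsum_zpow_tri_mul_qInv {z q : ℂ} (hz : z ≠ 0) (hq0 : q ≠ 0) (hq : ‖q‖ < 1) :
    ∑' n : ℤ, z ^ n * q ^ tri n * qInv q n = qProd (-z) q := by
  obtain ⟨C, hC0, hC⟩ := exists_norm_qInv_le hq
  have hsum : ∀ {z : ℂ}, z ≠ 0 → Summable fun n : ℤ => z ^ n * q ^ tri n * qInv q n := fun hz =>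
    (summable_norm_mul_of_le (summable_norm_zpow_tri hz hq0 hq) hC).of_norm
  have hfun : ∀ {z : ℂ}, z ≠ 0 → ∑' n : ℤ, z ^ n * q ^ tri n * qInv q n =
      (1 + z) * ∑' n : ℤ, (z * q) ^ n * q ^ tri n * qInv q n := by
    intro z hz
    have hzq : z * q ≠ 0 := mul_ne_zero hz hq0
    have h₁ : ∑' n : ℤ, z ^ n * q ^ tri n * qInv q n -
        ∑' n : ℤ, (z * q) ^ n * q ^ tri n * qInv q n =
        ∑' n : ℤ, z ^ n * q ^ tri n * qInv q (n - 1) := by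
      rw [← (hsum hz).tsum_sub (hsum hzq)]
      refine tsum_congr fun n => ?_
      rw [qInv_sub_one hq, mul_zpow]
      ring
    have h₂ : ∑' n : ℤ, z ^ n * q ^ tri n * qInv q (n - 1) =
        z * ∑' n : ℤ, (z * q) ^ n * q ^ tri n * qInv q n := by
      rw [← (Equiv.addRight (1 : ℤ)).tsum_eq, ← tsum_mul_left]
      refine tsum_congr fun n => ?_
      rw [Equiv.coe_addRight, tri_add_one, zpow_add₀ hz, zpow_add₀ hq0, mul_zpow,
        add_sub_cancel_right, zpow_one]
      ring
    linear_combination h₁ + h₂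
  have hiter : ∀ N : ℕ, ∑' n : ℤ, z ^ n * q ^ tri n * qInv q n =
      qFactorial (-z) q N * ∑' n : ℤ, (z * q ^ N) ^ n * q ^ tri n * qInv q n := by
    intro N
    induction N with
    | zero => simp [qFactorial]
    | succ N ih =>
      rw [ih, hfun (mul_ne_zero hz (pow_ne_zero N hq0)), qFactorial, qFactorial,
        Finset.prod_range_succ]
      have : z * q ^ N * q = z * q ^ (N + 1) := by ring
      rw [this]
      ring
  have hlim : Tendsto (fun N : ℕ => ∑' n : ℤ, (z * q ^ N) ^ n * q ^ tri n * qInv q n) atTop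
      (𝓝 (∑' n : ℤ, if n = 0 then 1 else 0)) := by
    refine tendsto_tsum_of_dominated_convergence
      (bound := fun n : ℤ => ‖z ^ n * q ^ tri n‖ * C)
      ((summable_norm_zpow_tri hz hq0 hq).mul_right C) (fun n => ?_)
      (Eventually.of_forall fun N n => ?_)
    · rcases lt_trichotomy n 0 with hn | rfl | hn
      · simp [qInv_of_neg q hn, hn.ne]
      · simp [qInv_zero, tri]
      · lift n to ℕ using hn.le
        have hn' : n ≠ 0 := by rintro rfl; simp at hn
        have h0 : Tendsto (fun N : ℕ => q ^ N) atTop (𝓝 0) :=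
          tendsto_pow_atTop_nhds_zero_of_norm_lt_one hq
        have h1 := (((h0.const_mul z).pow n).mul_const (q ^ tri n)).mul_const (qInv q n)
        simpa [hn'] using h1
    · rw [norm_mul]
      rcases lt_or_ge n 0 with hn | hn
      · rw [qInv_of_neg q hn, norm_zero, mul_zero]
        positivity
      · refine mul_le_mul ?_ (hC n) (norm_nonneg _) (norm_nonneg _)
        lift n to ℕ using hn
        rw [norm_mul, norm_mul]
        refine mul_le_mul_of_nonneg_right ?_ (norm_nonneg _)
        rw [zpow_natCast, zpow_natCast, norm_pow, norm_pow, norm_mul, norm_pow]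
        exact pow_le_pow_left₀ (by positivity)
          (mul_le_of_le_one_right (norm_nonneg z) (pow_le_one₀ (norm_nonneg q) hq.le)) n
  rw [tsum_ite_eq] at hlim
  have h := (tendsto_qFactorial (-z) hq).mul hlim
  rw [mul_one] at h
  exact tendsto_nhds_unique (tendsto_const_nhds.congr hiter) h

lemma summable_norm_quadratic_mul {s q : ℂ} (hs : s ≠ 0) (hq0 : q ≠ 0) (hq : ‖q‖ < 1) {A : ℕ}
    (hA : A ≠ 0) (B : ℤ) (i j : ℤ → ℤ) :
    Summable fun n : ℤ => ‖s ^ n * q ^ (A * tri n + B * n) * (qInv q (i n) * qInv q (j n))‖ := by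
  obtain ⟨C, hC0, hC⟩ := exists_norm_qInv_le hq
  refine summable_norm_mul_of_le (summable_norm_quadratic hs hq0 hq hA B) (C := C * C) fun n => ?_
  rw [norm_mul]
  exact mul_le_mul (hC _) (hC _) (norm_nonneg _) hC0

/-- The sum `∑ q^{s^2 + k s} / ((q; q)_s (q; q)_{s+k})` over Durfee rectangles of shape
`s × (s + k)`. -/
noncomputable def durfee (q : ℂ) (k : ℤ) : ℂ :=
  ∑' s : ℤ, q ^ (s ^ 2 + k * s) * (qInv q s * qInv q (s + k))

lemma summable_norm_durfee {q : ℂ} (hq0 : q ≠ 0) (hq : ‖q‖ < 1) (k l : ℤ) (i j : ℤ → ℤ) :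
    Summable fun s : ℤ => ‖q ^ (s ^ 2 + k * s + l) * (qInv q (i s) * qInv q (j s))‖ := by
  have h := (summable_norm_quadratic_mul one_ne_zero hq0 hq two_ne_zero (k + 1) i j).mul_left ‖q ^ l‖
  refine h.congr fun s => ?_
  rw [← norm_mul, one_zpow, one_mul, ← mul_assoc, ← zpow_add₀ hq0]
  have h₁ : l + (((2 : ℕ) : ℤ) * tri s + (k + 1) * s) = s ^ 2 + k * s + l := by
    have := two_mul_tri s
    push_cast
    linarith
  rw [h₁]

lemma durfee_neg {q : ℂ} (k : ℤ) : durfee q (-k) = durfee q k := by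
  rw [durfee, durfee, ← (Equiv.addRight k).tsum_eq]
  refine tsum_congr fun s => ?_
  rw [Equiv.coe_addRight, add_neg_cancel_right, mul_comm (qInv q s)]
  congr 2
  ring

lemma durfee_sub_durfee {q : ℂ} (hq0 : q ≠ 0) (hq : ‖q‖ < 1) (k : ℤ) :
    durfee q k - durfee q (k + 1) = -q ^ (k + 1) * (durfee q (k + 1) - durfee q (k + 2)) := by
  have hs : ∀ (k l : ℤ) (i j : ℤ → ℤ),
      Summable fun s : ℤ => q ^ (s ^ 2 + k * s + l) * (qInv q (i s) * qInv q (j s)) :=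
    fun k l i j => (summable_norm_durfee hq0 hq k l i j).of_norm
  have h₁ : durfee q k = ∑' s : ℤ, q ^ (s ^ 2 + k * s + 0) * (qInv q s * qInv q (s + (k + 1))) -
      ∑' s : ℤ, q ^ (s ^ 2 + (k + 1) * s + (k + 1)) * (qInv q s * qInv q (s + (k + 1))) := by
    rw [durfee, ← (hs _ _ _ _).tsum_sub (hs _ _ _ _)]
    refine tsum_congr fun s => ?_
    have h := qInv_sub_one hq (s + (k + 1))
    rw [show s + (k + 1) - 1 = s + k by ring] at h
    rw [h, show s ^ 2 + (k + 1) * s + (k + 1) = (s ^ 2 + k * s) + (s + (k + 1)) by ring, add_zero,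
      zpow_add₀ hq0 (s ^ 2 + k * s)]
    ring
  have h₂ : durfee q (k + 1) =
      ∑' s : ℤ, q ^ (s ^ 2 + k * s + 0) * (qInv q s * qInv q (s + (k + 1))) -
      ∑' s : ℤ, q ^ (s ^ 2 + k * s + 0) * (qInv q (s - 1) * qInv q (s + (k + 1))) := by
    rw [durfee, ← (hs _ _ _ _).tsum_sub (hs _ _ _ _)]
    refine tsum_congr fun s => ?_
    rw [qInv_sub_one hq, show s ^ 2 + (k + 1) * s = (s ^ 2 + k * s) + s by ring, add_zero,
      zpow_add₀ hq0 (s ^ 2 + k * s)]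
    ring
  have h₃ : ∑' s : ℤ, q ^ (s ^ 2 + (k + 1) * s + (k + 1)) * (qInv q s * qInv q (s + (k + 1))) =
      q ^ (k + 1) * durfee q (k + 1) := by
    rw [durfee, ← tsum_mul_left]
    refine tsum_congr fun s => ?_
    rw [zpow_add₀ hq0 _ (k + 1)]
    ring
  have h₄ : ∑' s : ℤ, q ^ (s ^ 2 + k * s + 0) * (qInv q (s - 1) * qInv q (s + (k + 1))) =
      q ^ (k + 1) * durfee q (k + 2) := by
    rw [durfee, ← tsum_mul_left, ← (Equiv.addRight (1 : ℤ)).tsum_eq]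
    refine tsum_congr fun s => ?_
    simp only [Equiv.coe_addRight]
    rw [add_sub_cancel_right, ← mul_assoc (q ^ (k + 1)), ← zpow_add₀ hq0,
      show s + 1 + (k + 1) = s + (k + 2) by ring]
    congr 2
    ring
  linear_combination h₁ - h₂ - h₃ + h₄

lemma tendsto_durfee {q : ℂ} (hq0 : q ≠ 0) (hq : ‖q‖ < 1) :
    Tendsto (fun k : ℕ => durfee q k) atTop (𝓝 (qProd q q)⁻¹) := by
  obtain ⟨C, hC0, hC⟩ := exists_norm_qInv_le hq
  have h : Tendsto (fun k : ℕ => durfee q k) atTop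
      (𝓝 (∑' s : ℤ, if s = 0 then (qProd q q)⁻¹ else 0)) := by
    refine tendsto_tsum_of_dominated_convergence
      (bound := fun s : ℤ => ‖q ^ (s ^ 2)‖ * (C * C)) ?_ (fun s => ?_)
      (Eventually.of_forall fun k s => ?_)
    · refine ((summable_norm_quadratic one_ne_zero hq0 hq two_ne_zero 1).mul_right (C * C)).congr
        fun s => ?_
      rw [one_zpow, one_mul, Nat.cast_ofNat, two_mul_tri, one_mul, sub_add_cancel]
    · rcases lt_trichotomy s 0 with hs | rfl | hs
      · simp [qInv_of_neg q hs, hs.ne]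
      · simpa [qInv_zero] using tendsto_qInv hq
      · lift s to ℕ using hs.le
        have hs' : s ≠ 0 := by rintro rfl; simp at hs
        have h0 : Tendsto (fun k : ℕ => ‖q ^ k‖ * (‖q ^ (s ^ 2)‖ * (C * C))) atTop (𝓝 0) := by
          simpa using (tendsto_pow_atTop_nhds_zero_of_norm_lt_one hq).norm.mul_const
            (‖q ^ (s ^ 2)‖ * (C * C))
        rw [if_neg (by exact_mod_cast hs')]
        refine squeeze_zero_norm (fun k => ?_) h0
        have h1 : q ^ ((s : ℤ) ^ 2 + (k : ℤ) * (s : ℤ)) = q ^ (s ^ 2) * q ^ (k * s) := by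
          rw [zpow_add₀ hq0]
          norm_cast
        have h2 : ‖q ^ (k * s)‖ ≤ ‖q ^ k‖ := by
          rw [norm_pow, norm_pow]
          exact pow_le_pow_of_le_one (norm_nonneg q) hq.le
            (Nat.le_mul_of_pos_right k (Nat.pos_of_ne_zero hs'))
        rw [h1, norm_mul, norm_mul, norm_mul]
        calc ‖q ^ (s ^ 2)‖ * ‖q ^ (k * s)‖ * (‖qInv q s‖ * ‖qInv q (s + k)‖)
            ≤ ‖q ^ (s ^ 2)‖ * ‖q ^ k‖ * (C * C) := by gcongr <;> exact hC _
          _ = _ := by ring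
    · rcases lt_or_ge s 0 with hs | hs
      · rw [qInv_of_neg q hs, zero_mul, mul_zero, norm_zero]
        positivity
      · lift s to ℕ using hs
        rw [zpow_add₀ hq0, norm_mul, norm_mul, norm_mul]
        have h2 : ‖q ^ ((k : ℤ) * (s : ℤ))‖ ≤ 1 := by
          have : q ^ ((k : ℤ) * (s : ℤ)) = q ^ (k * s) := by norm_cast
          rw [this, norm_pow]
          exact pow_le_one₀ (norm_nonneg q) hq.le
        calc ‖q ^ ((s : ℤ) ^ 2)‖ * ‖q ^ ((k : ℤ) * (s : ℤ))‖ * (‖qInv q s‖ * ‖qInv q (s + k)‖)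
            ≤ ‖q ^ ((s : ℤ) ^ 2)‖ * 1 * (C * C) := by gcongr <;> exact hC _
          _ = _ := by ring
  rwa [tsum_ite_eq] at h

/-- The Durfee rectangle identity: `durfee q k` does not depend on `k`. The differences
`durfee q k - durfee q (k + 1)` do not decrease in absolute value with `k` by `durfee_sub_durfee`,
but tend to zero, so they all vanish. -/
lemma durfee_eq {q : ℂ} (hq0 : q ≠ 0) (hq : ‖q‖ < 1) (k : ℤ) : durfee q k = (qProd q q)⁻¹ := by
  have hlim := tendsto_durfee hq0 hq
  have hd : ∀ k : ℕ, durfee q k - durfee q (k + 1 : ℕ) = 0 := by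
    have hmono : Monotone fun k : ℕ => ‖durfee q k - durfee q (k + 1 : ℕ)‖ := by
      refine monotone_nat_of_le_succ fun k => ?_
      have h := durfee_sub_durfee hq0 hq k
      have h' : q ^ ((k : ℤ) + 1) = q ^ (k + 1) := by norm_cast
      rw [h'] at h
      push_cast
      rw [h, show (k : ℤ) + 1 + 1 = k + 2 by ring, norm_mul, norm_neg, norm_pow]
      exact mul_le_of_le_one_left (norm_nonneg _) (pow_le_one₀ (norm_nonneg q) hq.le)
    have h0 : Tendsto (fun k : ℕ => ‖durfee q k - durfee q (k + 1 : ℕ)‖) atTop (𝓝 0) := by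
      simpa using (hlim.sub (hlim.comp (tendsto_add_atTop_nat 1))).norm
    exact fun k => norm_le_zero_iff.1 (hmono.ge_of_tendsto h0 k)
  have hconst : ∀ k : ℕ, durfee q k = durfee q (0 : ℕ) := by
    intro k
    induction k with
    | zero => rfl
    | succ k ih => rw [← ih]; exact (sub_eq_zero.1 (hd k)).symm
  have hnat : ∀ k : ℕ, durfee q k = (qProd q q)⁻¹ := fun k => by
    rw [hconst k]
    exact tendsto_nhds_unique (tendsto_const_nhds.congr fun n => (hconst n).symm) hlim
  rcases le_total 0 k with hk | hk
  · lift k to ℕ using hk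
    exact hnat k
  · rw [← durfee_neg]
    lift -k to ℕ using (by linarith) with n
    exact hnat n

/-! ### The Jacobi triple product -/

lemma f_eq_tsum_tri {a b : ℂ} (ha : a ≠ 0) :
    f a b = ∑' n : ℤ, a ^ n * (a * b) ^ tri n := by
  refine tsum_congr fun n => ?_
  rw [mul_add_one_div_two, ← tri, zpow_add₀ ha, mul_zpow]
  ring

/-- The Jacobi triple product: multiplying Euler's expansions of `(-a; ab)_∞` and `(-b; ab)_∞` and
collecting the terms of equal index difference gives the Durfee rectangle sums. -/
theorem f_eq_qProd {a b : ℂ} (ha : a ≠ 0) (hb : b ≠ 0) (hab : ‖a * b‖ < 1) :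
    f a b = qProd (-a) (a * b) * qProd (-b) (a * b) * qProd (a * b) (a * b) := by
  set q := a * b with hqdef
  have hq0 : q ≠ 0 := mul_ne_zero ha hb
  obtain ⟨C, hC0, hC⟩ := exists_norm_qInv_le hab
  have hs : ∀ {z : ℂ}, z ≠ 0 → Summable fun n : ℤ => ‖z ^ n * q ^ tri n * qInv q n‖ := fun hz =>
    summable_norm_mul_of_le (summable_norm_zpow_tri hz hq0 hab) hC
  have h : qProd (-a) q * qProd (-b) q = ∑' m : ℤ, a ^ m * q ^ tri m * durfee q m := by
    rw [← tsum_zpow_tri_mul_qInv ha hq0 hab, ← tsum_zpow_tri_mul_qInv hb hq0 hab,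
      tsum_mul_tsum_of_summable_norm (hs ha) (hs hb)]
    have hsum := summable_mul_of_summable_norm (hs ha) (hs hb)
    let e : ℤ × ℤ ≃ ℤ × ℤ :=
      { toFun := fun p => (p.2 + p.1, p.2)
        invFun := fun p => (p.1 - p.2, p.2)
        left_inv := fun p => by simp
        right_inv := fun p => by simp }
    rw [← e.tsum_eq]
    refine (Summable.tsum_prod (e.summable_iff.2 hsum)).trans ?_
    refine tsum_congr fun m => ?_
    rw [durfee, ← tsum_mul_left]
    refine tsum_congr fun j => ?_
    have h₁ : tri (j + m) + tri j + j = tri m + (j ^ 2 + m * j) := by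
      have h₁ := two_mul_tri j
      have h₂ := two_mul_tri m
      have h₃ := two_mul_tri (j + m)
      nlinarith
    calc a ^ (j + m) * q ^ tri (j + m) * qInv q (j + m) * (b ^ j * q ^ tri j * qInv q j)
        = a ^ m * (q ^ tri (j + m) * q ^ tri j * (a ^ j * b ^ j)) *
            (qInv q j * qInv q (j + m)) := by rw [zpow_add₀ ha]; ring
      _ = a ^ m * q ^ (tri (j + m) + tri j + j) * (qInv q j * qInv q (j + m)) := by
          rw [← mul_zpow, ← hqdef, ← zpow_add₀ hq0, ← zpow_add₀ hq0]
      _ = _ := by rw [h₁, zpow_add₀ hq0]; ring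
  have hP := qProd_ne_zero hab hab
  simp only [durfee_eq hq0 hab] at h
  rw [h, tsum_mul_right, f_eq_tsum_tri ha, ← hqdef]
  field_simp

/-! ### The Rogers--Ramanujan identities -/

/-- The finite sum `∑ (-1)^m q^{(3 m^2 + m) / 2} / ((q; q)_{s-m} (q; q)_{s+m+e})`, used for `e = 0`
and `e = 1`. -/
noncomputable def pentSum (q : ℂ) (e s : ℤ) : ℂ :=
  ∑' m : ℤ, (-1) ^ m * q ^ (3 * tri m + 2 * m) * (qInv q (s - m) * qInv q (s + m + e))

lemma summable_pent {q : ℂ} (hq0 : q ≠ 0) (hq : ‖q‖ < 1) (B : ℤ) (i j : ℤ → ℤ) :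
    Summable fun m : ℤ =>
      (-1) ^ m * q ^ (3 * tri m + B * m) * (qInv q (i m) * qInv q (j m)) :=
  (summable_norm_quadratic_mul (neg_ne_zero.2 one_ne_zero) hq0 hq three_ne_zero B i j).of_norm

lemma neg_one_zpow_neg (m : ℤ) : (-1 : ℂ) ^ (-m) = (-1) ^ m := by
  rw [zpow_neg, ← inv_zpow, inv_neg, inv_one]

lemma pentSum_zero_eq_pentSum_one {q : ℂ} (hq0 : q ≠ 0) (hq : ‖q‖ < 1) (s : ℤ) :
    pentSum q 0 s = pentSum q 1 s := by
  have h₀ : ∑' m : ℤ, (-1) ^ m * q ^ (3 * tri m + 3 * m) *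
      (qInv q (s - m) * qInv q (s + m + 1)) = 0 := by
    -- the substitution `m ↦ -m - 1` changes the sign of each term
    have h : ∑' m : ℤ, (-1) ^ m * q ^ (3 * tri m + 3 * m) *
        (qInv q (s - m) * qInv q (s + m + 1)) = -∑' m : ℤ, (-1) ^ m * q ^ (3 * tri m + 3 * m) *
        (qInv q (s - m) * qInv q (s + m + 1)) := by
      rw [← tsum_neg]
      conv_lhs => rw [← (Equiv.subLeft (-1 : ℤ)).tsum_eq]
      refine tsum_congr fun m => ?_
      rw [Equiv.subLeft_apply]
      have h₁ : 3 * tri (-1 - m) + 3 * (-1 - m) = 3 * tri m + 3 * m := by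
        have h₁ := two_mul_tri (-1 - m)
        have h₂ := two_mul_tri m
        nlinarith
      have h₂ : (-1 : ℂ) ^ (-1 - m) = -(-1) ^ m := by
        rw [show -1 - m = -(m + 1) by ring, neg_one_zpow_neg, zpow_add₀ (by norm_num), zpow_one]
        ring
      rw [h₁, h₂, show s - (-1 - m) = s + m + 1 by ring, show s + (-1 - m) + 1 = s - m by ring]
      ring
    exact self_eq_neg.1 h
  have h₁ : pentSum q 0 s = pentSum q 1 s - q ^ (s + 1) * ∑' m : ℤ, (-1) ^ m *
      q ^ (3 * tri m + 3 * m) * (qInv q (s - m) * qInv q (s + m + 1)) := by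
    rw [pentSum, pentSum, ← tsum_mul_left,
      ← (summable_pent hq0 hq _ _ _).tsum_sub ((summable_pent hq0 hq _ _ _).mul_left _)]
    refine tsum_congr fun m => ?_
    have h := qInv_sub_one hq (s + m + 1)
    rw [add_sub_cancel_right] at h
    rw [add_zero, h, show 3 * tri m + 3 * m = (3 * tri m + 2 * m) + m by ring,
      zpow_add₀ hq0 _ m, zpow_add₀ hq0 _ 1, zpow_add₀ hq0 _ 1, zpow_add₀ hq0 s]
    ring
  rw [h₁, h₀, mul_zero, sub_zero]

lemma pentSum_one_sub_one {q : ℂ} (hq0 : q ≠ 0) (hq : ‖q‖ < 1) (s : ℤ) :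
    pentSum q 1 (s - 1) = (1 - q ^ s) * pentSum q 0 s := by
  have h₀ : ∑' m : ℤ, (-1) ^ m * q ^ (3 * tri m + 1 * m) *
      (qInv q (s - m) * qInv q (s + m)) = pentSum q 0 s := by
    rw [pentSum, ← (Equiv.neg ℤ).tsum_eq]
    refine tsum_congr fun m => ?_
    rw [Equiv.neg_apply, neg_one_zpow_neg, tri_neg, sub_neg_eq_add, ← sub_eq_add_neg, add_zero,
      show 3 * (tri m + m) + 1 * -m = 3 * tri m + 2 * m by ring]
    ring
  have h₁ : pentSum q 1 (s - 1) = pentSum q 0 s - q ^ s * ∑' m : ℤ, (-1) ^ m *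
      q ^ (3 * tri m + 1 * m) * (qInv q (s - m) * qInv q (s + m)) := by
    rw [pentSum, pentSum, ← tsum_mul_left,
      ← (summable_pent hq0 hq _ _ _).tsum_sub ((summable_pent hq0 hq _ _ _).mul_left _)]
    refine tsum_congr fun m => ?_
    have h := qInv_sub_one hq (s - m)
    rw [show s - 1 - m = s - m - 1 by ring, show s - 1 + m + 1 = s + m by ring, h, add_zero,
      show 3 * tri m + 2 * m = (3 * tri m + 1 * m) + m by ring, zpow_add₀ hq0 _ m,
      zpow_sub₀ hq0]
    have := zpow_ne_zero m hq0
    field_simp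
  rw [h₁, h₀]
  ring

lemma pentSum_zero_eq {q : ℂ} (hq0 : q ≠ 0) (hq : ‖q‖ < 1) (s : ℤ) :
    pentSum q 0 s = qInv q s := by
  rcases lt_or_ge s 0 with hs | hs
  · rw [qInv_of_neg q hs, pentSum]
    refine (tsum_congr fun m => ?_).trans tsum_zero
    rcases le_total 0 m with hm | hm
    · rw [qInv_of_neg q (k := s - m) (by linarith), zero_mul, mul_zero]
    · rw [qInv_of_neg q (k := s + m + 0) (by linarith), mul_zero, mul_zero]
  · lift s to ℕ using hs
    induction s with
    | zero =>
      rw [pentSum, tsum_eq_single 0]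
      · simp [qInv_zero, tri]
      · intro m hm
        rcases lt_or_gt_of_ne hm with hm | hm
        · rw [qInv_of_neg q (k := _ + m + 0) (by simpa using hm), mul_zero, mul_zero]
        · rw [qInv_of_neg q (k := _ - m) (by simpa using hm), zero_mul, mul_zero]
    | succ s ih =>
      have h₁ := pentSum_one_sub_one hq0 hq (s + 1 : ℕ)
      have h₂ := qInv_sub_one hq (s + 1 : ℕ)
      have h₃ : ((s + 1 : ℕ) : ℤ) - 1 = s := by push_cast; ring
      rw [h₃] at h₁ h₂
      rw [← pentSum_zero_eq_pentSum_one hq0 hq, ih, h₂] at h₁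
      refine (mul_left_cancel₀ ?_ h₁).symm
      rw [zpow_natCast, pow_succ']
      exact one_sub_mul_pow_ne_zero hq hq s

/-- Both Rogers--Ramanujan identities, for `e = 0` and `e = 1`. The Durfee rectangle identity
expresses `q^{m^2 + e m} / (q; q)_∞` as a sum over `s`; after interchanging the summations the
inner sum over `m` is evaluated by `pentSum_zero_eq`. -/
lemma tsum_rogersRamanujan {q : ℂ} (hq0 : q ≠ 0) (hq : ‖q‖ < 1) {e : ℤ} (he : e = 0 ∨ e = 1) :
    (∑' m : ℤ, (-1) ^ m * q ^ (5 * tri m + (3 + e) * m)) * (qProd q q)⁻¹ =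
      ∑' s : ℤ, q ^ (s ^ 2 + e * s) * qInv q s := by
  have hpent : ∀ s, pentSum q e s = qInv q s := by
    intro s
    rcases he with rfl | rfl
    · exact pentSum_zero_eq hq0 hq s
    · rw [← pentSum_zero_eq_pentSum_one hq0 hq, pentSum_zero_eq hq0 hq s]
  have hsum : Summable (Function.uncurry fun m s : ℤ =>
      (-1) ^ m * q ^ (3 * tri m + 2 * m) * q ^ (s ^ 2 + e * s) *
        (qInv q (s - m) * qInv q (s + m + e))) := by
    obtain ⟨C, hC0, hC⟩ := exists_norm_qInv_le hq
    have h₁ := summable_norm_quadratic (neg_ne_zero.2 one_ne_zero) hq0 hq three_ne_zero 2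
    have h₂ := summable_norm_quadratic one_ne_zero hq0 hq two_ne_zero (e + 1)
    refine ((summable_norm_mul_of_le (h₁.mul_norm h₂) (C := C * C)
      (c := fun p : ℤ × ℤ => qInv q (p.2 - p.1) * qInv q (p.2 + p.1 + e)) fun p => ?_).congr
      fun p => ?_).of_norm
    · rw [norm_mul]
      exact mul_le_mul (hC _) (hC _) (norm_nonneg _) hC0
    · have h : ((2 : ℕ) : ℤ) * tri p.2 + (e + 1) * p.2 = p.2 ^ 2 + e * p.2 := by
        rw [Nat.cast_ofNat, two_mul_tri]
        ring
      rw [h, one_zpow, one_mul]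
      rfl
  have h₁ : ∀ s : ℤ, q ^ (s ^ 2 + e * s) * qInv q s =
      ∑' m : ℤ, (-1) ^ m * q ^ (3 * tri m + 2 * m) * q ^ (s ^ 2 + e * s) *
        (qInv q (s - m) * qInv q (s + m + e)) := by
    intro s
    rw [← hpent, pentSum, ← tsum_mul_left]
    exact tsum_congr fun m => by ring
  have h₂ : ∀ m : ℤ, (-1) ^ m * q ^ (5 * tri m + (3 + e) * m) * (qProd q q)⁻¹ =
      ∑' s : ℤ, (-1) ^ m * q ^ (3 * tri m + 2 * m) * q ^ (s ^ 2 + e * s) *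
        (qInv q (s - m) * qInv q (s + m + e)) := by
    intro m
    rw [← durfee_eq hq0 hq (2 * m + e), durfee, ← tsum_mul_left]
    conv_rhs => rw [← (Equiv.addRight m).tsum_eq]
    refine tsum_congr fun s => ?_
    have h : 5 * tri m + (3 + e) * m + (s ^ 2 + (2 * m + e) * s) =
        3 * tri m + 2 * m + ((s + m) ^ 2 + e * (s + m)) := by
      have := two_mul_tri m
      nlinarith
    rw [Equiv.coe_addRight, add_sub_cancel_right, show s + m + m + e = s + (2 * m + e) by ring,
      mul_assoc ((-1) ^ m) (q ^ (3 * tri m + 2 * m)), ← zpow_add₀ hq0, ← h, zpow_add₀ hq0 _ (_ + _)]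
    ring
  rw [← tsum_mul_right, tsum_congr h₁, tsum_congr h₂]
  exact hsum.tsum_comm.symm

/-! ### The identities in terms of theta series -/

lemma f_comm (a b : ℂ) : f a b = f b a := by
  rw [f, f, ← (Equiv.neg ℤ).tsum_eq]
  refine tsum_congr fun n => ?_
  rw [Equiv.neg_apply, show -n * (-n + 1) = n * (n - 1) by ring,
    show -n * (-n - 1) = n * (n + 1) by ring, mul_comm]

lemma norm_pow_lt_one {q : ℂ} (hq : ‖q‖ < 1) {n : ℕ} (hn : n ≠ 0) : ‖q ^ n‖ < 1 := by
  rw [norm_pow]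
  exact pow_lt_one₀ (norm_nonneg q) hq hn

/-- The theta series `f(-q^2, -q^3) = (q; q)_∞ G(q)`. -/
noncomputable def thetaG (q : ℂ) : ℂ := f (-q ^ 2) (-q ^ 3)

/-- The theta series `f(-q, -q^4) = (q; q)_∞ H(q)`. -/
noncomputable def thetaH (q : ℂ) : ℂ := f (-q) (-q ^ 4)

lemma qProd_split_two (a : ℂ) {q : ℂ} (hq : ‖q‖ < 1) :
    qProd a q = qProd a (q ^ 2) * qProd (a * q) (q ^ 2) := by
  simp [qProd_eq_prod a hq two_ne_zero, Finset.prod_range_succ]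

lemma E_eq_qProd {q : ℂ} (hq0 : q ≠ 0) (hq : ‖q‖ < 1) : E q = qProd q q := by
  have h : -q * -q ^ 2 = q ^ 3 := by ring
  rw [E, f_eq_qProd (neg_ne_zero.2 hq0) (neg_ne_zero.2 (pow_ne_zero 2 hq0))
    (by rw [h]; exact norm_pow_lt_one hq three_ne_zero), h, neg_neg, neg_neg,
    qProd_eq_prod q hq three_ne_zero]
  simp only [Finset.prod_range_succ, Finset.prod_range_zero]
  ring_nf

lemma E_ne_zero {q : ℂ} (hq0 : q ≠ 0) (hq : ‖q‖ < 1) : E q ≠ 0 := by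
  rw [E_eq_qProd hq0 hq]
  exact qProd_ne_zero hq hq

theorem G_mul_E {q : ℂ} (hq0 : q ≠ 0) (hq : ‖q‖ < 1) : G q * E q = thetaG q := by
  have h := tsum_rogersRamanujan hq0 hq (e := 0) (Or.inl rfl)
  have h₁ : thetaG q = ∑' m : ℤ, (-1) ^ m * q ^ (5 * tri m + (3 + 0) * m) := by
    rw [thetaG, f_comm, f_eq_tsum_tri (neg_ne_zero.2 (pow_ne_zero 3 hq0))]
    refine tsum_congr fun m => ?_
    rw [show -q ^ 3 * -q ^ 2 = q ^ 5 by ring, neg_eq_neg_one_mul, mul_zpow, zpow_add₀ hq0,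
      zpow_mul, zpow_mul]
    norm_cast
    ring
  have h₂ : G q = ∑' s : ℤ, q ^ (s ^ 2 + 0 * s) * qInv q s := by
    rw [tsum_mul_qInv, G]
    refine tsum_congr fun n => ?_
    rw [zero_mul, add_zero]
    norm_cast
  rw [h₂, ← h, ← h₁, E_eq_qProd hq0 hq, inv_mul_cancel_right₀ (qProd_ne_zero hq hq)]

theorem H_mul_E {q : ℂ} (hq0 : q ≠ 0) (hq : ‖q‖ < 1) : H q * E q = thetaH q := by
  have h := tsum_rogersRamanujan hq0 hq (e := 1) (Or.inr rfl)
  have h₁ : thetaH q = ∑' m : ℤ, (-1) ^ m * q ^ (5 * tri m + (3 + 1) * m) := by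
    rw [thetaH, f_comm, f_eq_tsum_tri (neg_ne_zero.2 (pow_ne_zero 4 hq0))]
    refine tsum_congr fun m => ?_
    rw [show -q ^ 4 * -q = q ^ 5 by ring, neg_eq_neg_one_mul, mul_zpow, zpow_add₀ hq0,
      zpow_mul, zpow_mul]
    norm_cast
    ring
  have h₂ : H q = ∑' s : ℤ, q ^ (s ^ 2 + 1 * s) * qInv q s := by
    rw [tsum_mul_qInv, H]
    refine tsum_congr fun n => ?_
    rw [show (n : ℤ) ^ 2 + 1 * n = ((n * (n + 1) : ℕ) : ℤ) by push_cast; ring, zpow_natCast]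
  rw [h₂, ← h, ← h₁, E_eq_qProd hq0 hq, inv_mul_cancel_right₀ (qProd_ne_zero hq hq)]

/-! ### The addition formula for `f` -/

/-- Splitting of a sum over `ℤ × ℤ` according to the residue of the first index modulo `N`. -/
lemma tsum_eq_sum_residues {F : ℤ × ℤ → ℂ} (hF : Summable F) {N : ℕ} (hN : N ≠ 0) :
    ∑' p, F p = ∑ r ∈ Finset.range N, ∑' p : ℤ × ℤ, F (N * p.1 + r, p.2) := by
  have : NeZero N := ⟨hN⟩
  let e : Fin N × (ℤ × ℤ) ≃ ℤ × ℤ :=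
    (Equiv.prodAssoc _ _ _).symm.trans
      (((Equiv.prodComm _ _).trans (Int.divModEquiv N).symm).prodCongr (Equiv.refl ℤ))
  have he : ∀ (r : Fin N) (p : ℤ × ℤ), e (r, p) = (N * p.1 + (r : ℕ), p.2) := by
    intro r p
    simp [e, Int.divModEquiv, mul_comm]
  rw [← e.tsum_eq]
  refine (Summable.tsum_prod (e.summable_iff.2 hF)).trans ?_
  rw [tsum_fintype, Finset.sum_range]
  exact Finset.sum_congr rfl fun r _ => tsum_congr fun p => congrArg F (he r p)

/-- The addition formula for products of two theta series with the same nome, obtained by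
splitting the double sum over `(m, n)` by the parity of `m - n`. -/
theorem f_mul_f {a b c d : ℂ} (ha : a ≠ 0) (hb : b ≠ 0) (hc : c ≠ 0) (hd : d ≠ 0)
    (h : a * b = c * d) (hlt : ‖a * b‖ < 1) :
    f a b * f c d = f (a * c) (b * d) * f (a * d) (b * c) +
      a * (f (a * c * (c * d)) (b / c) * f (a * d * (c * d)) (b / d)) := by
  have hab0 : a * b ≠ 0 := mul_ne_zero ha hb
  have hac : a * c ≠ 0 := mul_ne_zero ha hc
  have had : a * d ≠ 0 := mul_ne_zero ha hd
  set t := a * b with ht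
  have ht2 : t ^ 2 ≠ 0 := pow_ne_zero 2 hab0
  have ht2' : ‖t ^ 2‖ < 1 := norm_pow_lt_one hlt two_ne_zero
  rw [f_eq_tsum_tri ha, f_eq_tsum_tri hc, f_eq_tsum_tri hac, f_eq_tsum_tri had, ← h,
    f_eq_tsum_tri (mul_ne_zero hac hab0), f_eq_tsum_tri (mul_ne_zero had hab0), ← ht,
    show a * c * (b * d) = t ^ 2 by linear_combination (a * b) * (-h),
    show a * d * (b * c) = t ^ 2 by linear_combination (a * b) * (-h),
    show a * c * t * (b / c) = t ^ 2 by rw [ht]; field_simp,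
    show a * d * t * (b / d) = t ^ 2 by rw [ht]; field_simp]
  rw [tsum_mul_tsum_of_summable_norm (summable_norm_zpow_tri ha hab0 hlt)
      (summable_norm_zpow_tri hc hab0 hlt),
    tsum_mul_tsum_of_summable_norm (summable_norm_zpow_tri hac ht2 ht2')
      (summable_norm_zpow_tri had ht2 ht2'),
    tsum_mul_tsum_of_summable_norm (summable_norm_zpow_tri (mul_ne_zero hac hab0) ht2 ht2')
      (summable_norm_zpow_tri (mul_ne_zero had hab0) ht2 ht2')]
  have hsum := summable_mul_of_summable_norm (summable_norm_zpow_tri ha hab0 hlt)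
    (summable_norm_zpow_tri hc hab0 hlt)
  let e : ℤ × ℤ ≃ ℤ × ℤ :=
    { toFun := fun p => (p.1 + p.2, p.2)
      invFun := fun p => (p.1 - p.2, p.2)
      left_inv := fun p => by simp
      right_inv := fun p => by simp }
  let e' : ℤ × ℤ ≃ ℤ × ℤ :=
    { toFun := fun p => (p.2, p.1 - p.2)
      invFun := fun p => (p.1 + p.2, p.1)
      left_inv := fun p => by simp
      right_inv := fun p => by simp }
  have hd' : d = t / c := by rw [h]; field_simp
  clear_value t
  rw [← e.tsum_eq]
  refine (tsum_eq_sum_residues (e.summable_iff.2 hsum) two_ne_zero).trans ?_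
  rw [Finset.sum_range_succ, Finset.sum_range_one, ← tsum_mul_left]
  congr 1
  · rw [← e'.tsum_eq]
    refine tsum_congr fun ⟨u, v⟩ => ?_
    have h₁ : tri (2 * v + (0 : ℕ) + (u - v)) + tri (u - v) = 2 * tri u + (2 * tri v + v) := by
      have := two_mul_tri u
      have := two_mul_tri v
      have := two_mul_tri (u - v)
      have := two_mul_tri (2 * v + (0 : ℕ) + (u - v))
      push_cast at *
      nlinarith
    have h₂ : 2 * v + ((0 : ℕ) : ℤ) + (u - v) = u + v := by push_cast; ring
    calc a ^ (2 * v + ((0 : ℕ) : ℤ) + (u - v)) * t ^ tri (2 * v + (0 : ℕ) + (u - v)) *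
          (c ^ (u - v) * t ^ tri (u - v))
        = a ^ (u + v) * c ^ (u - v) *
            t ^ (tri (2 * v + (0 : ℕ) + (u - v)) + tri (u - v)) := by
          rw [zpow_add₀ hab0, h₂]; ring
      _ = (a * c) ^ u * (t ^ 2) ^ tri u * ((a * d) ^ v * (t ^ 2) ^ tri v) := by
          rw [h₁, zpow_add₀ hab0, zpow_add₀ hab0, zpow_add₀ ha, zpow_sub₀ hc, hd', mul_zpow,
            mul_zpow, div_zpow, zpow_mul, zpow_mul]
          norm_cast
          ring
  · rw [← e'.tsum_eq]
    refine tsum_congr fun ⟨u, v⟩ => ?_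
    have h₁ : tri (2 * v + (1 : ℕ) + (u - v)) + tri (u - v) =
        u + (2 * tri u + (v + (v + 2 * tri v))) := by
      have := two_mul_tri u
      have := two_mul_tri v
      have := two_mul_tri (u - v)
      have := two_mul_tri (2 * v + (1 : ℕ) + (u - v))
      push_cast at *
      nlinarith
    have h₂ : 2 * v + ((1 : ℕ) : ℤ) + (u - v) = 1 + (u + v) := by push_cast; ring
    calc a ^ (2 * v + ((1 : ℕ) : ℤ) + (u - v)) * t ^ tri (2 * v + (1 : ℕ) + (u - v)) *
          (c ^ (u - v) * t ^ tri (u - v))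
        = a ^ (1 + (u + v)) * c ^ (u - v) *
            t ^ (tri (2 * v + (1 : ℕ) + (u - v)) + tri (u - v)) := by
          rw [zpow_add₀ hab0, h₂]; ring
      _ = a * ((a * c * t) ^ u * (t ^ 2) ^ tri u * ((a * d * t) ^ v * (t ^ 2) ^ tri v)) := by
          rw [h₁, zpow_add₀ hab0, zpow_add₀ hab0, zpow_add₀ hab0, zpow_add₀ hab0, zpow_add₀ ha,
            zpow_add₀ ha, zpow_sub₀ hc, hd', mul_zpow, mul_zpow, mul_zpow, mul_zpow, div_zpow,
            zpow_mul, zpow_mul, zpow_one]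
          norm_cast
          ring

/-! ### Product identities -/

/-- The product `(q^i; q^N)_∞`. -/
noncomputable def pPos (q : ℂ) (i N : ℕ) : ℂ := qProd (q ^ i) (q ^ N)

/-- The product `(-q^i; q^N)_∞`. -/
noncomputable def pNeg (q : ℂ) (i N : ℕ) : ℂ := qProd (-q ^ i) (q ^ N)

section Products

variable {q : ℂ}

lemma pPos_two (hq : ‖q‖ < 1) (i : ℕ) {N : ℕ} (hN : N ≠ 0) :
    pPos q i N = pPos q i (N * 2) * pPos q (i + N) (N * 2) := by
  rw [pPos, qProd_split_two _ (norm_pow_lt_one hq hN), ← pow_mul, ← pow_add, pPos, pPos]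

lemma pNeg_two (hq : ‖q‖ < 1) (i : ℕ) {N : ℕ} (hN : N ≠ 0) :
    pNeg q i N = pNeg q i (N * 2) * pNeg q (i + N) (N * 2) := by
  rw [pNeg, qProd_split_two _ (norm_pow_lt_one hq hN), ← pow_mul, neg_mul, ← pow_add, pNeg, pNeg]

lemma pPos_five (hq : ‖q‖ < 1) (i : ℕ) {N : ℕ} (hN : N ≠ 0) :
    pPos q i N = pPos q i (N * 5) * pPos q (i + N) (N * 5) * pPos q (i + N * 2) (N * 5) *
      pPos q (i + N * 3) (N * 5) * pPos q (i + N * 4) (N * 5) := by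
  rw [pPos, qProd_eq_prod _ (norm_pow_lt_one hq hN) (n := 5) (by norm_num)]
  simp only [Finset.prod_range_succ, Finset.prod_range_zero, one_mul, mul_zero, add_zero, mul_one,
    pPos, ← pow_mul, ← pow_add]

lemma pPos_mul_pNeg (hq : ‖q‖ < 1) (i : ℕ) {N : ℕ} (hN : N ≠ 0) :
    pPos q i N * pNeg q i N = pPos q (i * 2) (N * 2) := by
  rw [pPos, pNeg, qProd_mul_qProd_neg _ (norm_pow_lt_one hq hN), pPos, pow_mul, pow_mul]

lemma f_pow_pow (hq0 : q ≠ 0) (hq : ‖q‖ < 1) {i : ℕ} (hi : i ≠ 0) (j : ℕ) :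
    f (q ^ i) (q ^ j) = pNeg q i (i + j) * pNeg q j (i + j) * pPos q (i + j) (i + j) := by
  have h : q ^ i * q ^ j = q ^ (i + j) := (pow_add q i j).symm
  rw [f_eq_qProd (pow_ne_zero i hq0) (pow_ne_zero j hq0)
    (by rw [h]; exact norm_pow_lt_one hq (by omega)), h, pNeg, pNeg, pPos]

lemma f_neg_pow_neg_pow (hq0 : q ≠ 0) (hq : ‖q‖ < 1) {i : ℕ} (hi : i ≠ 0) (j : ℕ) :
    f (-q ^ i) (-q ^ j) = pPos q i (i + j) * pPos q j (i + j) * pPos q (i + j) (i + j) := by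
  have h : -q ^ i * -q ^ j = q ^ (i + j) := by rw [neg_mul_neg, pow_add]
  rw [f_eq_qProd (neg_ne_zero.2 (pow_ne_zero i hq0)) (neg_ne_zero.2 (pow_ne_zero j hq0))
    (by rw [h]; exact norm_pow_lt_one hq (by omega)), h, neg_neg, neg_neg, pPos, pPos, pPos]

/-- The nome of `f(q^i, -q^j)` is `-q^{i+j}`; each of the three products is split in two, so that
all factors have base `q^{2(i+j)}`. -/
lemma f_pow_neg_pow (hq0 : q ≠ 0) (hq : ‖q‖ < 1) {i : ℕ} (hi : i ≠ 0) (j : ℕ) :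
    f (q ^ i) (-q ^ j) = pNeg q i ((i + j) * 2) * pPos q (i + (i + j)) ((i + j) * 2) *
      (pPos q j ((i + j) * 2) * pNeg q (j + (i + j)) ((i + j) * 2)) *
      (pNeg q (i + j) ((i + j) * 2) * pPos q ((i + j) * 2) ((i + j) * 2)) := by
  have h : q ^ i * -q ^ j = -q ^ (i + j) := by rw [mul_neg, pow_add]
  have hn : ‖-q ^ (i + j)‖ < 1 := by rw [norm_neg]; exact norm_pow_lt_one hq (by omega)
  have h₂ : (-q ^ (i + j)) ^ 2 = q ^ ((i + j) * 2) := by rw [neg_sq, pow_mul]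
  rw [f_eq_qProd (pow_ne_zero i hq0) (neg_ne_zero.2 (pow_ne_zero j hq0)) (by rwa [h]), h, neg_neg,
    qProd_split_two _ hn, qProd_split_two (q ^ j) hn, qProd_split_two (-q ^ (i + j)) hn, h₂,
    neg_mul_neg, neg_mul_neg, mul_neg, ← pow_add, ← pow_add, ← pow_two, ← pow_mul]
  simp only [pNeg, pPos]

lemma E_pow (hq0 : q ≠ 0) (hq : ‖q‖ < 1) {n : ℕ} (hn : n ≠ 0) : E (q ^ n) = pPos q n n :=
  E_eq_qProd (pow_ne_zero n hq0) (norm_pow_lt_one hq hn)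

lemma phi_neg_pow (hq0 : q ≠ 0) (hq : ‖q‖ < 1) {n : ℕ} (hn : n ≠ 0) :
    phi (-q ^ n) = pPos q n (n + n) * pPos q n (n + n) * pPos q (n + n) (n + n) :=
  f_neg_pow_neg_pow hq0 hq hn n

lemma psi_neg_eq (hq0 : q ≠ 0) (hq : ‖q‖ < 1) :
    psi (-q) = pPos q 1 4 * pPos q 3 4 * pPos q 4 4 := by
  rw [psi, ← f_neg_pow_neg_pow hq0 hq one_ne_zero 3, pow_one, Odd.neg_pow (by decide)]

lemma thetaG_eq (hq0 : q ≠ 0) (hq : ‖q‖ < 1) {n : ℕ} (hn : n ≠ 0) :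
    thetaG (q ^ n) = pPos q (n * 2) (n * 5) * pPos q (n * 3) (n * 5) * pPos q (n * 5) (n * 5) := by
  rw [thetaG, ← pow_mul, ← pow_mul, f_neg_pow_neg_pow hq0 hq (by omega), ← mul_add]

lemma thetaH_eq (hq0 : q ≠ 0) (hq : ‖q‖ < 1) {n : ℕ} (hn : n ≠ 0) :
    thetaH (q ^ n) = pPos q n (n * 5) * pPos q (n * 4) (n * 5) * pPos q (n * 5) (n * 5) := by
  rw [thetaH, ← pow_mul, f_neg_pow_neg_pow hq0 hq (by omega), show n + n * 4 = n * 5 by ring]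

lemma E_mul_E_neg (hq0 : q ≠ 0) (hq : ‖q‖ < 1) : phi (-q ^ 2) * E (q ^ 2) = E q * E (-q) := by
  have h₁ : E q = qProd q (q ^ 2) * qProd (q ^ 2) (q ^ 2) := by
    rw [E_eq_qProd hq0 hq, qProd_split_two _ hq, ← pow_two]
  have h₂ : E (-q) = qProd (-q) (q ^ 2) * qProd (q ^ 2) (q ^ 2) := by
    rw [E_eq_qProd (neg_ne_zero.2 hq0) (by rwa [norm_neg]),
      qProd_split_two _ (by rwa [norm_neg]), neg_mul_neg, ← pow_two, neg_sq]
  have h₃ : qProd q (q ^ 2) * qProd (-q) (q ^ 2) = pPos q 2 4 := by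
    rw [qProd_mul_qProd_neg _ (norm_pow_lt_one hq two_ne_zero), pPos, ← pow_mul]
  have h₄ : qProd (q ^ 2) (q ^ 2) = pPos q 2 4 * pPos q 4 4 := pPos_two hq 2 two_ne_zero
  rw [phi_neg_pow hq0 hq two_ne_zero, E_pow hq0 hq two_ne_zero, h₁, h₂]
  simp only [pPos] at h₃ h₄ ⊢
  linear_combination qProd (q ^ 2) (q ^ 2) * (qProd (q ^ 2) (q ^ 4) * (-h₄) -
    qProd (q ^ 2) (q ^ 2) * h₃)

lemma psi_neg_mul_E (hq0 : q ≠ 0) (hq : ‖q‖ < 1) :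
    psi (-q) * E (q ^ 2) = E q * E (q ^ 4) := by
  have h₁ := E_pow hq0 hq one_ne_zero
  have h₂ : pPos q 1 1 = pPos q 1 2 * pPos q 2 2 := pPos_two hq 1 one_ne_zero
  have h₃ : pPos q 1 2 = pPos q 1 4 * pPos q 3 4 := pPos_two hq 1 two_ne_zero
  rw [pow_one] at h₁
  rw [psi_neg_eq hq0 hq, E_pow hq0 hq two_ne_zero, E_pow hq0 hq four_ne_zero, h₁, h₂, h₃]
  ring

lemma phi_neg_sq_ne_zero (hq0 : q ≠ 0) (hq : ‖q‖ < 1) : phi (-q ^ 2) ≠ 0 := by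
  have h := E_mul_E_neg hq0 hq
  intro h0
  rw [h0, zero_mul] at h
  exact mul_ne_zero (E_ne_zero hq0 hq) (E_ne_zero (neg_ne_zero.2 hq0) (by rwa [norm_neg])) h.symm

lemma psi_neg_ne_zero (hq0 : q ≠ 0) (hq : ‖q‖ < 1) : psi (-q) ≠ 0 := by
  have h := psi_neg_mul_E hq0 hq
  intro h0
  rw [h0, zero_mul] at h
  exact mul_ne_zero (E_ne_zero hq0 hq) (E_ne_zero (pow_ne_zero 4 hq0)
    (norm_pow_lt_one hq four_ne_zero)) h.symm

lemma thetaG_base_ten (hq0 : q ≠ 0) (hq : ‖q‖ < 1) :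
    thetaG q = pPos q 2 10 * pPos q 7 10 * (pPos q 3 10 * pPos q 8 10) *
      (pPos q 5 10 * pPos q 10 10) := by
  have h := thetaG_eq hq0 hq one_ne_zero
  have h₁ : pPos q 2 5 = pPos q 2 10 * pPos q 7 10 := pPos_two hq 2 (by norm_num)
  have h₂ : pPos q 3 5 = pPos q 3 10 * pPos q 8 10 := pPos_two hq 3 (by norm_num)
  have h₃ : pPos q 5 5 = pPos q 5 10 * pPos q 10 10 := pPos_two hq 5 (by norm_num)
  rw [pow_one] at h
  simpa only [one_mul, h₁, h₂, h₃] using h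

lemma thetaH_base_ten (hq0 : q ≠ 0) (hq : ‖q‖ < 1) :
    thetaH q = pPos q 1 10 * pPos q 6 10 * (pPos q 4 10 * pPos q 9 10) *
      (pPos q 5 10 * pPos q 10 10) := by
  have h := thetaH_eq hq0 hq one_ne_zero
  have h₁ : pPos q 1 5 = pPos q 1 10 * pPos q 6 10 := pPos_two hq 1 (by norm_num)
  have h₂ : pPos q 4 5 = pPos q 4 10 * pPos q 9 10 := pPos_two hq 4 (by norm_num)
  have h₃ : pPos q 5 5 = pPos q 5 10 * pPos q 10 10 := pPos_two hq 5 (by norm_num)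
  rw [pow_one] at h
  simpa only [one_mul, h₁, h₂, h₃] using h

lemma thetaG_neg_base_ten (hq0 : q ≠ 0) (hq : ‖q‖ < 1) :
    thetaG (-q) = pNeg q 3 10 * pPos q 8 10 * (pPos q 2 10 * pNeg q 7 10) *
      (pNeg q 5 10 * pPos q 10 10) := by
  have h : thetaG (-q) = f (q ^ 3) (-q ^ 2) := by
    rw [thetaG, f_comm, neg_sq, Odd.neg_pow (by decide), neg_neg]
  rw [h]
  exact f_pow_neg_pow hq0 hq three_ne_zero 2

lemma thetaH_neg_base_ten (hq0 : q ≠ 0) (hq : ‖q‖ < 1) :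
    thetaH (-q) = pNeg q 1 10 * pPos q 6 10 * (pPos q 4 10 * pNeg q 9 10) *
      (pNeg q 5 10 * pPos q 10 10) := by
  have h : thetaH (-q) = f (q ^ 1) (-q ^ 4) := by
    rw [thetaH, neg_neg, Even.neg_pow (by decide), pow_one]
  rw [h]
  exact f_pow_neg_pow hq0 hq one_ne_zero 4

lemma phi_neg_sq_base_twenty (hq0 : q ≠ 0) (hq : ‖q‖ < 1) :
    phi (-q ^ 2) = (pPos q 2 20 * pPos q 6 20 * pPos q 10 20 * pPos q 14 20 * pPos q 18 20) ^ 2 *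
      (pPos q 4 20 * pPos q 8 20 * pPos q 12 20 * pPos q 16 20 * pPos q 20 20) := by
  have h : phi (-q ^ 2) = pPos q 2 4 * pPos q 2 4 * pPos q 4 4 := phi_neg_pow hq0 hq two_ne_zero
  have h₁ : pPos q 2 4 = pPos q 2 20 * pPos q 6 20 * pPos q 10 20 * pPos q 14 20 * pPos q 18 20 :=
    pPos_five hq 2 four_ne_zero
  have h₂ : pPos q 4 4 = pPos q 4 20 * pPos q 8 20 * pPos q 12 20 * pPos q 16 20 * pPos q 20 20 :=
    pPos_five hq 4 four_ne_zero
  rw [h, h₁, h₂]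
  ring

lemma thetaG_mul_thetaG_neg (hq0 : q ≠ 0) (hq : ‖q‖ < 1) :
    thetaG q * thetaG (-q) = phi (-q ^ 2) * f (q ^ 4) (q ^ 6) := by
  have ten : (10 : ℕ) ≠ 0 := by norm_num
  have h : f (q ^ 4) (q ^ 6) = pNeg q 4 10 * pNeg q 6 10 * pPos q 10 10 :=
    f_pow_pow hq0 hq four_ne_zero 6
  have e₂ : pPos q 2 10 = pPos q 2 20 * pPos q 12 20 := pPos_two hq 2 ten
  have e₈ : pPos q 8 10 = pPos q 8 20 * pPos q 18 20 := pPos_two hq 8 ten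
  have e₁₀ : pPos q 10 10 = pPos q 10 20 * pPos q 20 20 := pPos_two hq 10 ten
  have e₄ : pPos q 4 10 = pPos q 4 20 * pPos q 14 20 := pPos_two hq 4 ten
  have e₆ : pPos q 6 10 = pPos q 6 20 * pPos q 16 20 := pPos_two hq 6 ten
  have m₃ : pPos q 3 10 * pNeg q 3 10 = pPos q 6 20 := pPos_mul_pNeg hq 3 ten
  have m₇ : pPos q 7 10 * pNeg q 7 10 = pPos q 14 20 := pPos_mul_pNeg hq 7 ten
  have m₅ : pPos q 5 10 * pNeg q 5 10 = pPos q 10 20 := pPos_mul_pNeg hq 5 ten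
  have m₄ : pPos q 4 10 * pNeg q 4 10 = pPos q 8 20 := pPos_mul_pNeg hq 4 ten
  have m₆ : pPos q 6 10 * pNeg q 6 10 = pPos q 12 20 := pPos_mul_pNeg hq 6 ten
  have hL : thetaG q * thetaG (-q) = (pPos q 2 10) ^ 2 * (pPos q 8 10) ^ 2 * (pPos q 10 10) ^ 2 *
      ((pPos q 3 10 * pNeg q 3 10) * (pPos q 7 10 * pNeg q 7 10) *
        (pPos q 5 10 * pNeg q 5 10)) := by
    rw [thetaG_base_ten hq0 hq, thetaG_neg_base_ten hq0 hq]
    ring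
  have hR : phi (-q ^ 2) * f (q ^ 4) (q ^ 6) =
      (pPos q 2 20 * pPos q 10 20 * pPos q 18 20) ^ 2 * pPos q 6 20 * pPos q 14 20 *
      (pPos q 8 20 * pPos q 12 20 * pPos q 20 20) * pPos q 10 10 *
      ((pPos q 4 10 * pNeg q 4 10) * (pPos q 6 10 * pNeg q 6 10)) := by
    rw [h, phi_neg_sq_base_twenty hq0 hq, e₄, e₆]
    ring
  rw [hL, hR, m₃, m₇, m₅, m₄, m₆, e₂, e₈, e₁₀]
  ring

lemma thetaH_mul_thetaH_neg (hq0 : q ≠ 0) (hq : ‖q‖ < 1) :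
    thetaH q * thetaH (-q) = phi (-q ^ 2) * f (q ^ 2) (q ^ 8) := by
  have ten : (10 : ℕ) ≠ 0 := by norm_num
  have h : f (q ^ 2) (q ^ 8) = pNeg q 2 10 * pNeg q 8 10 * pPos q 10 10 :=
    f_pow_pow hq0 hq two_ne_zero 8
  have e₂ : pPos q 2 10 = pPos q 2 20 * pPos q 12 20 := pPos_two hq 2 ten
  have e₈ : pPos q 8 10 = pPos q 8 20 * pPos q 18 20 := pPos_two hq 8 ten
  have e₁₀ : pPos q 10 10 = pPos q 10 20 * pPos q 20 20 := pPos_two hq 10 ten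
  have e₄ : pPos q 4 10 = pPos q 4 20 * pPos q 14 20 := pPos_two hq 4 ten
  have e₆ : pPos q 6 10 = pPos q 6 20 * pPos q 16 20 := pPos_two hq 6 ten
  have m₁ : pPos q 1 10 * pNeg q 1 10 = pPos q 2 20 := pPos_mul_pNeg hq 1 ten
  have m₉ : pPos q 9 10 * pNeg q 9 10 = pPos q 18 20 := pPos_mul_pNeg hq 9 ten
  have m₅ : pPos q 5 10 * pNeg q 5 10 = pPos q 10 20 := pPos_mul_pNeg hq 5 ten
  have m₂ : pPos q 2 10 * pNeg q 2 10 = pPos q 4 20 := pPos_mul_pNeg hq 2 ten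
  have m₈ : pPos q 8 10 * pNeg q 8 10 = pPos q 16 20 := pPos_mul_pNeg hq 8 ten
  have hL : thetaH q * thetaH (-q) = (pPos q 6 10) ^ 2 * (pPos q 4 10) ^ 2 * (pPos q 10 10) ^ 2 *
      ((pPos q 1 10 * pNeg q 1 10) * (pPos q 9 10 * pNeg q 9 10) *
        (pPos q 5 10 * pNeg q 5 10)) := by
    rw [thetaH_base_ten hq0 hq, thetaH_neg_base_ten hq0 hq]
    ring
  have hR : phi (-q ^ 2) * f (q ^ 2) (q ^ 8) =
      (pPos q 6 20 * pPos q 10 20 * pPos q 14 20) ^ 2 * pPos q 2 20 * pPos q 18 20 *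
      (pPos q 4 20 * pPos q 16 20 * pPos q 20 20) * pPos q 10 10 *
      ((pPos q 2 10 * pNeg q 2 10) * (pPos q 8 10 * pNeg q 8 10)) := by
    rw [h, phi_neg_sq_base_twenty hq0 hq, e₂, e₈]
    ring
  rw [hL, hR, m₁, m₉, m₅, m₂, m₈, e₄, e₆, e₁₀]
  ring

lemma psi_neg_base_twenty (hq0 : q ≠ 0) (hq : ‖q‖ < 1) :
    psi (-q) = (pPos q 1 20 * pPos q 5 20 * pPos q 9 20 * pPos q 13 20 * pPos q 17 20) *
      (pPos q 3 20 * pPos q 7 20 * pPos q 11 20 * pPos q 15 20 * pPos q 19 20) *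
      (pPos q 4 20 * pPos q 8 20 * pPos q 12 20 * pPos q 16 20 * pPos q 20 20) := by
  have h₁ : pPos q 1 4 = pPos q 1 20 * pPos q 5 20 * pPos q 9 20 * pPos q 13 20 * pPos q 17 20 :=
    pPos_five hq 1 four_ne_zero
  have h₂ : pPos q 3 4 = pPos q 3 20 * pPos q 7 20 * pPos q 11 20 * pPos q 15 20 * pPos q 19 20 :=
    pPos_five hq 3 four_ne_zero
  have h₃ : pPos q 4 4 = pPos q 4 20 * pPos q 8 20 * pPos q 12 20 * pPos q 16 20 * pPos q 20 20 :=
    pPos_five hq 4 four_ne_zero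
  rw [psi_neg_eq hq0 hq, h₁, h₂, h₃]

lemma pPos_ten (hq : ‖q‖ < 1) (i : ℕ) : pPos q i 10 = pPos q i 20 * pPos q (i + 10) 20 :=
  pPos_two hq i (by norm_num)

lemma thetaH_mul_thetaG_pow_four (hq0 : q ≠ 0) (hq : ‖q‖ < 1) :
    thetaH q * thetaG (q ^ 4) = psi (-q) * f (q ^ 3) (q ^ 7) := by
  have ten : (10 : ℕ) ≠ 0 := by norm_num
  have h : f (q ^ 3) (q ^ 7) = pNeg q 3 10 * pNeg q 7 10 * pPos q 10 10 :=
    f_pow_pow hq0 hq three_ne_zero 7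
  have hG : thetaG (q ^ 4) = pPos q 8 20 * pPos q 12 20 * pPos q 20 20 :=
    thetaG_eq hq0 hq four_ne_zero
  have m₃ : pPos q 3 10 * pNeg q 3 10 = pPos q 6 20 := pPos_mul_pNeg hq 3 ten
  have m₇ : pPos q 7 10 * pNeg q 7 10 = pPos q 14 20 := pPos_mul_pNeg hq 7 ten
  have e₃ : pPos q 3 10 = pPos q 3 20 * pPos q 13 20 := pPos_ten hq 3
  have e₇ : pPos q 7 10 = pPos q 7 20 * pPos q 17 20 := pPos_ten hq 7
  have hR : psi (-q) * f (q ^ 3) (q ^ 7) =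
      (pPos q 1 20 * pPos q 5 20 * pPos q 9 20 * pPos q 11 20 * pPos q 15 20 * pPos q 19 20) *
      (pPos q 4 20 * pPos q 8 20 * pPos q 12 20 * pPos q 16 20 * pPos q 20 20) * pPos q 10 10 *
      ((pPos q 3 10 * pNeg q 3 10) * (pPos q 7 10 * pNeg q 7 10)) := by
    rw [h, psi_neg_base_twenty hq0 hq, e₃, e₇]
    ring
  rw [hR, m₃, m₇, hG, thetaH_base_ten hq0 hq, pPos_ten hq 1, pPos_ten hq 6, pPos_ten hq 4,
    pPos_ten hq 9, pPos_ten hq 5]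
  norm_num only
  ring

lemma thetaG_mul_thetaH_pow_four (hq0 : q ≠ 0) (hq : ‖q‖ < 1) :
    thetaG q * thetaH (q ^ 4) = psi (-q) * f (q ^ 1) (q ^ 9) := by
  have ten : (10 : ℕ) ≠ 0 := by norm_num
  have h : f (q ^ 1) (q ^ 9) = pNeg q 1 10 * pNeg q 9 10 * pPos q 10 10 :=
    f_pow_pow hq0 hq one_ne_zero 9
  have hH : thetaH (q ^ 4) = pPos q 4 20 * pPos q 16 20 * pPos q 20 20 :=
    thetaH_eq hq0 hq four_ne_zero
  have m₁ : pPos q 1 10 * pNeg q 1 10 = pPos q 2 20 := pPos_mul_pNeg hq 1 ten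
  have m₉ : pPos q 9 10 * pNeg q 9 10 = pPos q 18 20 := pPos_mul_pNeg hq 9 ten
  have e₁ : pPos q 1 10 = pPos q 1 20 * pPos q 11 20 := pPos_ten hq 1
  have e₉ : pPos q 9 10 = pPos q 9 20 * pPos q 19 20 := pPos_ten hq 9
  have hR : psi (-q) * f (q ^ 1) (q ^ 9) =
      (pPos q 3 20 * pPos q 5 20 * pPos q 7 20 * pPos q 13 20 * pPos q 15 20 * pPos q 17 20) *
      (pPos q 4 20 * pPos q 8 20 * pPos q 12 20 * pPos q 16 20 * pPos q 20 20) * pPos q 10 10 *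
      ((pPos q 1 10 * pNeg q 1 10) * (pPos q 9 10 * pNeg q 9 10)) := by
    rw [h, psi_neg_base_twenty hq0 hq, e₁, e₉]
    ring
  rw [hR, m₁, m₉, hH, thetaG_base_ten hq0 hq, pPos_ten hq 2, pPos_ten hq 7, pPos_ten hq 3,
    pPos_ten hq 8, pPos_ten hq 5]
  norm_num only
  ring

lemma psi_mul_phi_neg_sq (hq0 : q ≠ 0) (hq : ‖q‖ < 1) :
    psi q * phi (-q ^ 2) = psi (-q) * phi q := by
  have h₁ : psi q = pNeg q 1 4 * pNeg q 3 4 * pPos q 4 4 := by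
    rw [psi, ← f_pow_pow hq0 hq one_ne_zero 3, pow_one]
  have h₂ : phi q = pNeg q 1 2 * pNeg q 1 2 * pPos q 2 2 := by
    rw [phi, ← f_pow_pow hq0 hq one_ne_zero 1, pow_one]
  have h₃ : phi (-q ^ 2) = pPos q 2 4 * pPos q 2 4 * pPos q 4 4 := phi_neg_pow hq0 hq two_ne_zero
  have h₄ : pNeg q 1 2 = pNeg q 1 4 * pNeg q 3 4 := pNeg_two hq 1 two_ne_zero
  have h₅ : pPos q 2 2 = pPos q 2 4 * pPos q 4 4 := pPos_two hq 2 two_ne_zero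
  have h₆ : pPos q 2 4 = pPos q 2 8 * pPos q 6 8 := pPos_two hq 2 four_ne_zero
  have m₁ : pPos q 1 4 * pNeg q 1 4 = pPos q 2 8 := pPos_mul_pNeg hq 1 four_ne_zero
  have m₃ : pPos q 3 4 * pNeg q 3 4 = pPos q 6 8 := pPos_mul_pNeg hq 3 four_ne_zero
  rw [← m₁, ← m₃] at h₆
  rw [h₁, h₂, h₃, psi_neg_eq hq0 hq, h₄, h₅]
  linear_combination (pNeg q 1 4 * pNeg q 3 4 * pPos q 4 4 ^ 2 * pPos q 2 4) * h₆

/-- The product form of `ψ`: `(q; q^2)_∞ ψ(q) = (q^2; q^2)_∞`. -/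
lemma qProd_mul_psi (hq0 : q ≠ 0) (hq : ‖q‖ < 1) :
    qProd q (q ^ 2) * psi q = qProd (q ^ 2) (q ^ 2) := by
  have h₁ : psi q = pNeg q 1 4 * pNeg q 3 4 * pPos q 4 4 := by
    rw [psi, ← f_pow_pow hq0 hq one_ne_zero 3, pow_one]
  have h₂ : qProd q (q ^ 2) = pPos q 1 4 * pPos q 3 4 := by
    have := pPos_two hq 1 two_ne_zero
    rwa [pPos, pow_one] at this
  have h₃ : qProd (q ^ 2) (q ^ 2) = pPos q 2 4 * pPos q 4 4 := pPos_two hq 2 two_ne_zero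
  have h₆ : pPos q 2 4 = pPos q 2 8 * pPos q 6 8 := pPos_two hq 2 four_ne_zero
  have m₁ : pPos q 1 4 * pNeg q 1 4 = pPos q 2 8 := pPos_mul_pNeg hq 1 four_ne_zero
  have m₃ : pPos q 3 4 * pNeg q 3 4 = pPos q 6 8 := pPos_mul_pNeg hq 3 four_ne_zero
  rw [h₁, h₂, h₃, h₆, ← m₁, ← m₃]
  ring

/-- The quotient `g(q) h(-q) / φ(-q^2)`, where `g = thetaG` and `h = thetaH`. Up to a common factor
the left-hand side is `f(q, q^9) f(-q^3, -q^7)`; the addition formula writes it as a sum of two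
terms, and each of them is a product. -/
theorem thetaG_mul_thetaH_neg (hq0 : q ≠ 0) (hq : ‖q‖ < 1) :
    thetaG q * thetaH (-q) = phi (-q ^ 2) * (psi (q ^ 2) + q * psi (q ^ 10)) := by
  have ten : (10 : ℕ) ≠ 0 := by norm_num
  have hf₁ : f q (q ^ 9) = pNeg q 1 10 * pNeg q 9 10 * pPos q 10 10 := by
    have := f_pow_pow hq0 hq one_ne_zero 9
    rwa [pow_one] at this
  have hf₂ : f (-q ^ 3) (-q ^ 7) = pPos q 3 10 * pPos q 7 10 * pPos q 10 10 :=
    f_neg_pow_neg_pow hq0 hq three_ne_zero 7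
  have hf₃ : f (-q ^ 4) (-q ^ 16) = pPos q 4 20 * pPos q 16 20 * pPos q 20 20 :=
    f_neg_pow_neg_pow hq0 hq (by norm_num) 16
  have hf₄ : f (-q ^ 8) (-q ^ 12) = pPos q 8 20 * pPos q 12 20 * pPos q 20 20 :=
    f_neg_pow_neg_pow hq0 hq (by norm_num) 12
  have hf₅ : f (-q ^ 14) (-q ^ 6) = pPos q 14 20 * pPos q 6 20 * pPos q 20 20 :=
    f_neg_pow_neg_pow hq0 hq (by norm_num) 6
  have hf₆ : f (-q ^ 18) (-q ^ 2) = pPos q 18 20 * pPos q 2 20 * pPos q 20 20 :=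
    f_neg_pow_neg_pow hq0 hq (by norm_num) 2
  have hadd : f q (q ^ 9) * f (-q ^ 3) (-q ^ 7) = f (-q ^ 4) (-q ^ 16) * f (-q ^ 8) (-q ^ 12) +
      q * (f (-q ^ 14) (-q ^ 6) * f (-q ^ 18) (-q ^ 2)) := by
    have hn : ∀ n : ℕ, q ^ n ≠ 0 := fun n => pow_ne_zero n hq0
    rw [f_mul_f hq0 (hn 9) (neg_ne_zero.2 (hn 3)) (neg_ne_zero.2 (hn 7)) (by ring)
      (by rw [← pow_succ']; exact norm_pow_lt_one hq ten)]
    congr 2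
    · congr 1 <;> ring
    · congr 1 <;> ring
    · congr 1
      · congr 1
        · ring
        · field_simp
      · congr 1
        · ring
        · field_simp
  have hψ₁ : pPos q 2 4 * psi (q ^ 2) = pPos q 4 4 := by
    have := qProd_mul_psi (hq0 := pow_ne_zero 2 hq0) (norm_pow_lt_one hq two_ne_zero)
    rwa [← pow_mul] at this
  have hψ₂ : pPos q 10 20 * psi (q ^ 10) = pPos q 20 20 := by
    have := qProd_mul_psi (hq0 := pow_ne_zero 10 hq0) (norm_pow_lt_one hq ten)
    rwa [← pow_mul] at this
  have m₅ : pPos q 5 10 * pNeg q 5 10 = pPos q 10 20 := pPos_mul_pNeg hq 5 ten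
  have e₂₄ : pPos q 2 4 = pPos q 2 20 * pPos q 6 20 * pPos q 10 20 * pPos q 14 20 * pPos q 18 20 :=
    pPos_five hq 2 four_ne_zero
  have e₄₄ : pPos q 4 4 = pPos q 4 20 * pPos q 8 20 * pPos q 12 20 * pPos q 16 20 * pPos q 20 20 :=
    pPos_five hq 4 four_ne_zero
  have e₂ : pPos q 2 10 = pPos q 2 20 * pPos q 12 20 := pPos_ten hq 2
  have e₈ : pPos q 8 10 = pPos q 8 20 * pPos q 18 20 := pPos_ten hq 8
  have e₄ : pPos q 4 10 = pPos q 4 20 * pPos q 14 20 := pPos_ten hq 4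
  have e₆ : pPos q 6 10 = pPos q 6 20 * pPos q 16 20 := pPos_ten hq 6
  have hL : thetaG q * thetaH (-q) =
      (pPos q 2 10 * pPos q 8 10 * pPos q 4 10 * pPos q 6 10 * (pPos q 5 10 * pNeg q 5 10)) *
      (f q (q ^ 9) * f (-q ^ 3) (-q ^ 7)) := by
    rw [thetaG_base_ten hq0 hq, thetaH_neg_base_ten hq0 hq, hf₁, hf₂]
    ring
  have hφ : phi (-q ^ 2) = pPos q 2 4 * pPos q 2 4 * pPos q 4 4 := phi_neg_pow hq0 hq two_ne_zero
  have hR : phi (-q ^ 2) * (psi (q ^ 2) + q * psi (q ^ 10)) =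
      pPos q 2 4 * pPos q 4 4 * (pPos q 2 4 * psi (q ^ 2)) +
      q * (pPos q 2 20 * pPos q 6 20 * pPos q 14 20 * pPos q 18 20) ^ 2 * pPos q 10 20 *
        pPos q 4 4 * (pPos q 10 20 * psi (q ^ 10)) := by
    rw [hφ, e₂₄]
    ring
  rw [hL, hadd, hR, hψ₁, hψ₂, hf₃, hf₄, hf₅, hf₆, m₅, e₂, e₈, e₄, e₆, e₂₄, e₄₄]
  ring

end Products

/-! ### One-dimensional theta series along residue classes -/

/-- The theta series `∑ s^n w^{(N n + r)^2}` over the integers congruent to `r` modulo `N`, with a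
sign `s = ± 1`. Up to a power of `w` it is a value of `f` at powers of `w` (see `theta_eq_f`), so it
covers `φ`, `ψ`, `thetaG` and `thetaH`. -/
noncomputable def theta (s w : ℂ) (N : ℕ) (r : ℤ) : ℂ := ∑' n : ℤ, s ^ n * w ^ ((N * n + r) ^ 2)

section Theta

variable {s w : ℂ} {N : ℕ}

lemma zpow_neg_eq (hs : s = 1 ∨ s = -1) (n : ℤ) : s ^ (-n) = s ^ n := by
  rcases hs with rfl | rfl
  · simp
  · exact neg_one_zpow_neg n

lemma sign_ne_zero (hs : s = 1 ∨ s = -1) : s ≠ 0 := by rcases hs with rfl | rfl <;> norm_num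

lemma summable_norm_sq (hw0 : w ≠ 0) (hw : ‖w‖ < 1) : Summable fun n : ℤ => ‖w ^ (n ^ 2)‖ := by
  refine (summable_norm_quadratic one_ne_zero hw0 hw two_ne_zero 1).congr fun n => ?_
  rw [one_zpow, one_mul, Nat.cast_ofNat, two_mul_tri, one_mul, sub_add_cancel]

lemma norm_sign_zpow (hs : s = 1 ∨ s = -1) (n : ℤ) : ‖s ^ n‖ = 1 := by
  rcases hs with rfl | rfl <;> simp

lemma summable_norm_theta (hs : s = 1 ∨ s = -1) (hw0 : w ≠ 0) (hw : ‖w‖ < 1) (hN : N ≠ 0)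
    (r : ℤ) : Summable fun n : ℤ => ‖s ^ n * w ^ ((N * n + r) ^ 2)‖ := by
  have hinj : Function.Injective fun n : ℤ => (N : ℤ) * n + r := fun m n h => by simpa [hN] using h
  refine ((summable_norm_sq hw0 hw).comp_injective hinj).congr fun n => ?_
  rw [norm_mul, norm_sign_zpow hs, one_mul]
  rfl

lemma theta_neg (hs : s = 1 ∨ s = -1) (r : ℤ) : theta s w N (-r) = theta s w N r := by
  rw [theta, theta, ← (Equiv.neg ℤ).tsum_eq]
  refine tsum_congr fun n => ?_
  rw [Equiv.neg_apply, zpow_neg_eq hs]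
  congr 2
  ring

lemma theta_add_mul (hs : s = 1 ∨ s = -1) (r k : ℤ) :
    theta s w N (r + N * k) = s ^ k * theta s w N r := by
  rw [theta, theta, ← tsum_mul_left]
  conv_rhs => rw [← (Equiv.addRight k).tsum_eq]
  refine tsum_congr fun n => ?_
  rw [Equiv.coe_addRight, zpow_add₀ (sign_ne_zero hs), show (N : ℤ) * (n + k) + r =
    N * n + (r + N * k) by ring]
  have h : s ^ k * s ^ k = 1 := by
    nth_rw 1 [← zpow_neg_eq hs]
    rw [← zpow_add₀ (sign_ne_zero hs), neg_add_cancel, zpow_zero]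
  linear_combination (-(s ^ n * w ^ ((N * n + (r + N * k)) ^ 2))) * h

lemma theta_scale (c : ℕ) (r : ℤ) : theta s w (c * N) (c * r) = theta s (w ^ (c ^ 2)) N r := by
  rw [theta, theta]
  refine tsum_congr fun n => ?_
  rw [← zpow_natCast w, ← zpow_mul]
  congr 2
  push_cast
  ring

/-- The series `theta s w N r` in terms of `f`; the exponents `k`, `l` are `N^2 ± 2 N r`. -/
lemma theta_eq_f (hs : s = 1 ∨ s = -1) (hw0 : w ≠ 0) {r : ℕ} {k l : ℕ} (h₁ : k + 2 * N * r = N ^ 2)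
    (h₂ : l = N ^ 2 + 2 * N * r) : theta s w N r = w ^ (r ^ 2) * f (s * w ^ k) (s * w ^ l) := by
  have hss : s * s = 1 := by rcases hs with rfl | rfl <;> norm_num
  rw [← theta_neg hs, theta, f_eq_tsum_tri (mul_ne_zero (sign_ne_zero hs) (pow_ne_zero _ hw0)),
    ← tsum_mul_left]
  refine tsum_congr fun n => ?_
  have h₃ : s * w ^ k * (s * w ^ l) = w ^ (k + l) := by
    rw [pow_add]; linear_combination (w ^ k * w ^ l) * hss
  have h₄ : ((N : ℤ) * n + -r) ^ 2 = (r ^ 2 : ℕ) + k * n + (k + l : ℕ) * tri n := by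
    have h₁' : (k : ℤ) = N ^ 2 - 2 * N * r := by rw [eq_sub_iff_add_eq]; exact_mod_cast h₁
    have := two_mul_tri n
    rw [h₂]
    push_cast
    rw [h₁']
    linear_combination (-(N : ℤ) ^ 2) * this
  rw [h₃, h₄, zpow_add₀ hw0, zpow_add₀ hw0, zpow_mul, zpow_mul, zpow_natCast, zpow_natCast,
    zpow_natCast, mul_zpow]
  ring

lemma tsum_int_even_add_odd {F : ℤ → ℂ} (hF : Summable F) :
    ∑' n, F n = ∑' n : ℤ, F (2 * n) + ∑' n : ℤ, F (2 * n + 1) := by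
  let e : Fin 2 × ℤ ≃ ℤ := (Equiv.prodComm _ _).trans (Int.divModEquiv 2).symm
  have he : ∀ (r : Fin 2) (n : ℤ), e (r, n) = 2 * n + (r : ℕ) := by
    intro r n
    simp [e, Int.divModEquiv, mul_comm]
  rw [← e.tsum_eq]
  refine (Summable.tsum_prod (e.summable_iff.2 hF)).trans ?_
  rw [tsum_fintype, Fin.sum_univ_two]
  simp [he]

lemma theta_one_zero (hw0 : w ≠ 0) : theta 1 w 1 0 = phi w := by
  have h := theta_eq_f (s := 1) (w := w) (N := 1) (r := 0) (k := 1) (l := 1) (Or.inl rfl) hw0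
    (by norm_num) (by norm_num)
  simpa [phi] using h

lemma theta_neg_one_zero (hw0 : w ≠ 0) : theta (-1) w 1 0 = phi (-w) := by
  have h := theta_eq_f (s := -1) (w := w) (N := 1) (r := 0) (k := 1) (l := 1) (Or.inr rfl) hw0
    (by norm_num) (by norm_num)
  simpa [phi] using h

lemma theta_two_one (hw0 : w ≠ 0) (hw : ‖w‖ < 1) : theta 1 w 2 1 = 2 * w * psi (w ^ 8) := by
  have h₁ : theta 1 w 4 1 = w * psi (w ^ 8) := by
    have h := theta_eq_f (s := 1) (w := w) (N := 4) (r := 1) (k := 8) (l := 24) (Or.inl rfl) hw0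
      (by norm_num) (by norm_num)
    rw [psi, ← pow_mul]
    simpa using h
  have h₃ : theta 1 w 4 3 = theta 1 w 4 1 := by
    have h := theta_add_mul (s := 1) (w := w) (N := 4) (Or.inl rfl) (-1) 1
    rw [theta_neg (Or.inl rfl)] at h
    simpa using h
  have h : theta 1 w 2 1 = theta 1 w 4 1 + theta 1 w 4 3 := by
    rw [theta, tsum_int_even_add_odd
      (summable_norm_theta (Or.inl rfl) hw0 hw two_ne_zero 1).of_norm, theta, theta]
    congr 1 <;>
    · refine tsum_congr fun n => ?_
      rw [one_zpow, one_zpow]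
      congr 2
      push_cast
      ring
  rw [h, h₃, h₁]
  ring

end Theta

/-! ### Rotations of the plane lattice -/

lemma summable_lattice {s w₁ w₂ : ℂ} (hs : s = 1 ∨ s = -1) (h₁0 : w₁ ≠ 0) (h₁ : ‖w₁‖ < 1)
    (h₂0 : w₂ ≠ 0) (h₂ : ‖w₂‖ < 1) {g : ℤ × ℤ → ℤ × ℤ} (hg : Function.Injective g) (e : ℤ × ℤ → ℤ) :
    Summable fun p : ℤ × ℤ => s ^ e p * (w₁ ^ ((g p).1 ^ 2) * w₂ ^ ((g p).2 ^ 2)) := by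
  have h := ((summable_norm_sq h₁0 h₁).mul_norm (summable_norm_sq h₂0 h₂)).comp_injective hg
  refine (h.congr fun p => ?_).of_norm
  rw [norm_mul (s ^ e p), norm_sign_zpow hs, one_mul]
  rfl

/-- A double series over the points `(x, y)` with `x ≡ l y (mod 5 d)` and `y ≡ e (mod d)`, expanded
as a sum over the residues of `y` modulo `5 d` of products of one-dimensional theta series. On the
left-hand side the points are `y = d p.1 + e`, `x = l y + 5 d p.2`. For suitable weights
`w₁ = w^A`, `w₂ = w^B` the form `A x^2 + B y^2` is divisible by `5` on this sublattice, so that the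
same series is also the theta series of another quadratic form. -/
theorem tsum_rotate {s w₁ w₂ : ℂ} (hs : s = 1 ∨ s = -1) (h₁0 : w₁ ≠ 0) (h₁ : ‖w₁‖ < 1)
    (h₂0 : w₂ ≠ 0) (h₂ : ‖w₂‖ < 1) {d : ℕ} (hd : d ≠ 0) (e l : ℤ) :
    ∑' p : ℤ × ℤ, s ^ p.2 *
        (w₁ ^ ((l * (d * p.1 + e) + 5 * d * p.2) ^ 2) * w₂ ^ ((d * p.1 + e) ^ 2)) =
      ∑ r ∈ Finset.range 5, theta s w₁ (5 * d) (l * (d * r + e)) *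
        theta (s ^ l) w₂ (5 * d) (d * r + e) := by
  have hd' : (d : ℤ) ≠ 0 := by exact_mod_cast hd
  have hsl : s ^ l = 1 ∨ s ^ l = -1 := by
    rcases hs with rfl | rfl
    · simp
    · rcases Int.even_or_odd l with h | h
      · exact Or.inl h.neg_one_zpow
      · exact Or.inr h.neg_one_zpow
  have hinj : Function.Injective fun p : ℤ × ℤ => (l * (d * p.1 + e) + 5 * d * p.2, d * p.1 + e) := by
    rintro ⟨a, b⟩ ⟨a', b'⟩ h
    simp only [Prod.mk.injEq] at h ⊢
    have ha : a = a' := mul_left_cancel₀ hd' (by linarith [h.2])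
    subst ha
    exact ⟨rfl, mul_left_cancel₀ (mul_ne_zero (by norm_num : (5 : ℤ) ≠ 0) hd') (by linarith [h.1])⟩
  rw [tsum_eq_sum_residues (summable_lattice hs h₁0 h₁ h₂0 h₂ hinj Prod.snd) (N := 5) (by norm_num)]
  refine Finset.sum_congr rfl fun r _ => ?_
  have hd5 : 5 * d ≠ 0 := by positivity
  rw [theta, theta, tsum_mul_tsum_of_summable_norm (summable_norm_theta hs h₁0 h₁ hd5 _)
    (summable_norm_theta hsl h₂0 h₂ hd5 _)]
  let g : ℤ × ℤ ≃ ℤ × ℤ :=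
    { toFun := fun p => (p.2, p.1 - l * p.2)
      invFun := fun p => (p.2 + l * p.1, p.1)
      left_inv := fun p => by simp
      right_inv := fun p => by simp }
  rw [← g.tsum_eq]
  refine tsum_congr fun ⟨n, m⟩ => ?_
  change s ^ (n - l * m) * (w₁ ^ ((l * (d * ((5 : ℕ) * m + r) + e) + 5 * d * (n - l * m)) ^ 2) *
    w₂ ^ ((d * ((5 : ℕ) * m + r) + e) ^ 2)) = s ^ n * w₁ ^ (((5 * d : ℕ) * n + l * (d * r + e)) ^ 2) *
    ((s ^ l) ^ m * w₂ ^ (((5 * d : ℕ) * m + (d * r + e)) ^ 2))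
  have e₁ : l * (d * ((5 : ℕ) * m + r) + e) + 5 * d * (n - l * m) =
      (5 * d : ℕ) * n + l * (d * r + e) := by push_cast; ring
  have e₂ : (d : ℤ) * ((5 : ℕ) * m + r) + e = (5 * d : ℕ) * m + (d * r + e) := by push_cast; ring
  rw [e₁, e₂, sub_eq_add_neg, zpow_add₀ (sign_ne_zero hs), zpow_neg_eq hs, zpow_mul]
  ring

/-- The case of modulus `5` of `tsum_rotate`, with trivial signs. -/
lemma tsum_rotate_five {w₁ w₂ : ℂ} (h₁0 : w₁ ≠ 0) (h₁ : ‖w₁‖ < 1) (h₂0 : w₂ ≠ 0)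
    (h₂ : ‖w₂‖ < 1) (l : ℤ) :
    ∑' p : ℤ × ℤ, w₁ ^ ((l * p.1 + 5 * p.2) ^ 2) * w₂ ^ (p.1 ^ 2) =
      theta 1 w₁ 5 0 * theta 1 w₂ 5 0 + 2 * (theta 1 w₁ 5 l * theta 1 w₂ 5 1) +
        2 * (theta 1 w₁ 5 (2 * l) * theta 1 w₂ 5 2) := by
  have h := tsum_rotate (s := 1) (Or.inl rfl) h₁0 h₁ h₂0 h₂ one_ne_zero 0 l
  have hp : ∀ (w : ℂ) (r k : ℤ), theta 1 w 5 (r + 5 * k) = theta 1 w 5 r := fun w r k => by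
    have := theta_add_mul (s := 1) (w := w) (N := 5) (Or.inl rfl) r k
    rwa [one_zpow, one_mul] at this
  have hn : ∀ (w : ℂ) (r : ℤ), theta 1 w 5 (-r) = theta 1 w 5 r := fun w r =>
    theta_neg (Or.inl rfl) r
  have e₃ : ∀ (w : ℂ) (k : ℤ), theta 1 w 5 (k * 3) = theta 1 w 5 (2 * k) := fun w k => by
    rw [show k * 3 = -(2 * k) + 5 * k by ring, hp, hn]
  have e₄ : ∀ (w : ℂ) (k : ℤ), theta 1 w 5 (k * 4) = theta 1 w 5 k := fun w k => by
    rw [show k * 4 = -k + 5 * k by ring, hp, hn]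
  have e₃' := e₃ w₂ 1
  have e₄' := e₄ w₂ 1
  simp only [Finset.sum_range_succ, Finset.sum_range_zero, one_zpow, one_mul, Nat.cast_zero,
    Nat.cast_one, Nat.cast_ofNat, add_zero, mul_zero, zero_add, mul_one] at h e₃' e₄'
  rw [h, e₃, e₄, e₃', e₄', mul_comm l 2]
  ring

/-- The case of modulus `10` of `tsum_rotate`, for `y` odd and `l` odd. -/
lemma tsum_rotate_ten {s w₁ w₂ : ℂ} (hs : s = 1 ∨ s = -1) (h₁0 : w₁ ≠ 0) (h₁ : ‖w₁‖ < 1)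
    (h₂0 : w₂ ≠ 0) (h₂ : ‖w₂‖ < 1) {l : ℤ} (hl : Odd l) :
    ∑' p : ℤ × ℤ, s ^ p.2 *
        (w₁ ^ ((l * (2 * p.1 + 1) + 10 * p.2) ^ 2) * w₂ ^ ((2 * p.1 + 1) ^ 2)) =
      2 * (theta s w₁ 10 l * theta s w₂ 10 1) + 2 * (theta s w₁ 10 (3 * l) * theta s w₂ 10 3) +
        theta s w₁ 10 5 * theta s w₂ 10 5 := by
  have h := tsum_rotate hs h₁0 h₁ h₂0 h₂ two_ne_zero 1 l
  have hsl : s ^ l = s := by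
    rcases hs with rfl | rfl
    · simp
    · exact hl.neg_one_zpow
  have hss : s * s = 1 := by rcases hs with rfl | rfl <;> norm_num
  have hp : ∀ (w : ℂ) (r k : ℤ), theta s w 10 (r + 10 * k) = s ^ k * theta s w 10 r := fun w r k =>
    theta_add_mul hs r k
  have hn : ∀ (w : ℂ) (r : ℤ), theta s w 10 (-r) = theta s w 10 r := fun w r => theta_neg hs r
  have e₇ : ∀ (w : ℂ) {k : ℤ}, s ^ k = s → theta s w 10 (k * 7) = s * theta s w 10 (3 * k) :=
    fun w k hk => by rw [show k * 7 = -(3 * k) + 10 * k by ring, hp, hn, hk]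
  have e₉ : ∀ (w : ℂ) {k : ℤ}, s ^ k = s → theta s w 10 (k * 9) = s * theta s w 10 k :=
    fun w k hk => by rw [show k * 9 = -k + 10 * k by ring, hp, hn, hk]
  have e₇' := e₇ w₂ (zpow_one s)
  have e₉' := e₉ w₂ (zpow_one s)
  have e₅ : theta s w₁ 10 (l * 5) * theta s w₂ 10 5 = theta s w₁ 10 5 * theta s w₂ 10 5 := by
    obtain ⟨k, rfl⟩ := hl
    have h5 : theta s w₂ 10 5 = s * theta s w₂ 10 5 := by
      have := hp w₂ (-5) 1
      rw [hn, zpow_one] at this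
      simpa using this
    rw [show (2 * k + 1) * 5 = 5 + 10 * k by ring, hp]
    rcases hs with rfl | rfl
    · simp
    · have h0 : theta (-1) w₂ 10 5 = 0 := self_eq_neg.1 (by simpa using h5)
      rw [h0, mul_zero, mul_zero]
  simp only [Finset.sum_range_succ, Finset.sum_range_zero, hsl, Nat.cast_zero, Nat.cast_one,
    Nat.cast_ofNat, mul_zero, zero_add, mul_one, one_mul] at h e₇' e₉'
  norm_num only at h
  rw [h, e₅, e₇ w₁ hsl, e₉ w₁ hsl, e₇', e₉', mul_comm l 3]
  linear_combination (theta s w₁ 10 (3 * l) * theta s w₂ 10 3 +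
    theta s w₁ 10 l * theta s w₂ 10 1) * hss

/-! ### Evaluation of the theta series modulo `5` and `10` -/

lemma exists_root {q : ℂ} (hq0 : q ≠ 0) (hq : ‖q‖ < 1) {n : ℕ} (hn : n ≠ 0) :
    ∃ w : ℂ, w ^ n = q ∧ w ≠ 0 ∧ ‖w‖ < 1 := by
  obtain ⟨w, rfl⟩ := IsAlgClosed.exists_pow_nat_eq q (Nat.pos_of_ne_zero hn)
  refine ⟨w, rfl, fun h => hq0 (by rw [h, zero_pow hn]), ?_⟩
  rw [norm_pow] at hq
  exact lt_of_not_ge fun h => absurd (one_le_pow₀ h) (not_le.2 hq)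

section Values

variable {w : ℂ}

lemma theta_ten_one (hw0 : w ≠ 0) : theta 1 w 10 1 = w * f (w ^ 80) (w ^ 120) := by
  simpa using theta_eq_f (s := 1) (N := 10) (r := 1) (k := 80) (l := 120) (Or.inl rfl) hw0
    (by norm_num) (by norm_num)

lemma theta_ten_three (hw0 : w ≠ 0) : theta 1 w 10 3 = w ^ 9 * f (w ^ 40) (w ^ 160) := by
  simpa using theta_eq_f (s := 1) (N := 10) (r := 3) (k := 40) (l := 160) (Or.inl rfl) hw0
    (by norm_num) (by norm_num)

lemma theta_ten_five (hw0 : w ≠ 0) (hw : ‖w‖ < 1) :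
    theta 1 w 10 5 = 2 * w ^ 25 * psi (w ^ 200) := by
  have h := theta_scale (s := 1) (w := w) (N := 2) 5 1
  norm_num at h
  rw [h, theta_two_one (pow_ne_zero _ hw0) (norm_pow_lt_one hw (by norm_num)), ← pow_mul]

lemma theta_neg_ten_one (hw0 : w ≠ 0) : theta (-1) w 10 1 = w * thetaG (w ^ 40) := by
  rw [thetaG, ← pow_mul, ← pow_mul]
  simpa using theta_eq_f (s := -1) (N := 10) (r := 1) (k := 80) (l := 120) (Or.inr rfl) hw0
    (by norm_num) (by norm_num)

lemma theta_neg_ten_three (hw0 : w ≠ 0) : theta (-1) w 10 3 = w ^ 9 * thetaH (w ^ 40) := by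
  rw [thetaH, ← pow_mul]
  simpa using theta_eq_f (s := -1) (N := 10) (r := 3) (k := 40) (l := 160) (Or.inr rfl) hw0
    (by norm_num) (by norm_num)

/-- The classes `5` and `-5` modulo `10` agree, so the sum for `s = -1` vanishes. -/
lemma theta_ten_five_sign {s : ℂ} (hs : s = 1 ∨ s = -1) : theta s w 10 5 = s * theta s w 10 5 := by
  have h := theta_add_mul (w := w) (N := 10) hs (-5) 1
  rw [theta_neg hs] at h
  simpa using h

lemma theta_neg_ten_five : theta (-1) w 10 5 = 0 :=
  self_eq_neg.1 (by simpa using theta_ten_five_sign (w := w) (Or.inr rfl))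

lemma theta_ten_nine {s : ℂ} (hs : s = 1 ∨ s = -1) : theta s w 10 9 = s * theta s w 10 1 := by
  have h := theta_add_mul (w := w) (N := 10) hs (-1) 1
  rw [theta_neg hs] at h
  simpa using h

lemma theta_five_zero (hw0 : w ≠ 0) : theta 1 w 5 0 = phi (w ^ 25) := by
  have h := theta_scale (s := 1) (w := w) (N := 1) 5 0
  norm_num at h
  rw [h, theta_one_zero (pow_ne_zero _ hw0)]

lemma theta_five_one (hw0 : w ≠ 0) : theta 1 w 5 1 = w * f (w ^ 15) (w ^ 35) := by
  simpa using theta_eq_f (s := 1) (N := 5) (r := 1) (k := 15) (l := 35) (Or.inl rfl) hw0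
    (by norm_num) (by norm_num)

lemma theta_five_two (hw0 : w ≠ 0) : theta 1 w 5 2 = w ^ 4 * f (w ^ 5) (w ^ 45) := by
  simpa using theta_eq_f (s := 1) (N := 5) (r := 2) (k := 5) (l := 45) (Or.inl rfl) hw0
    (by norm_num) (by norm_num)

lemma theta_five_neg_add (r k : ℤ) : theta 1 w 5 (-r + 5 * k) = theta 1 w 5 r := by
  have h := theta_add_mul (s := 1) (w := w) (N := 5) (Or.inl rfl) (-r) k
  rwa [one_zpow, one_mul, theta_neg (Or.inl rfl)] at h

end Values

/-! ### Theta series of binary quadratic forms -/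

section Forms

variable {q : ℂ}

lemma summable_form (hq0 : q ≠ 0) (hq : ‖q‖ < 1) {a c D : ℕ} {b : ℤ} (ha : a ≠ 0) (hD0 : D ≠ 0)
    (hD : (D : ℤ) = 4 * a * c - b ^ 2) :
    Summable fun p : ℤ × ℤ => q ^ (a * p.1 ^ 2 + b * p.1 * p.2 + c * p.2 ^ 2) := by
  obtain ⟨w, rfl, hw0, hw⟩ := exists_root hq0 hq (n := 4 * a) (by positivity)
  have ha' : (a : ℤ) ≠ 0 := by exact_mod_cast ha
  have hinj : Function.Injective fun p : ℤ × ℤ => (2 * a * p.1 + b * p.2, p.2) := by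
    rintro ⟨x, y⟩ ⟨x', y'⟩ h
    simp only [Prod.mk.injEq] at h ⊢
    obtain ⟨h₁, rfl⟩ := h
    exact ⟨mul_left_cancel₀ (mul_ne_zero two_ne_zero ha') (by linarith), rfl⟩
  refine (summable_lattice (s := 1) (Or.inl rfl) hw0 hw (pow_ne_zero D hw0)
    (norm_pow_lt_one hw hD0) hinj fun _ => 0).congr fun p => ?_
  rw [one_zpow, one_mul, ← zpow_natCast w D, ← zpow_mul, ← zpow_add₀ hw0,
    ← zpow_natCast w (4 * a), ← zpow_mul]
  congr 1
  push_cast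
  rw [hD]
  ring

lemma form_diagonal (hq0 : q ≠ 0) (hq : ‖q‖ < 1) {A B : ℕ} (hA : A ≠ 0) (hB : B ≠ 0) :
    form A 0 B q = phi (q ^ A) * phi (q ^ B) := by
  have hA0 := pow_ne_zero A hq0
  have hB0 := pow_ne_zero B hq0
  rw [← theta_one_zero hA0, ← theta_one_zero hB0, theta, theta, tsum_mul_tsum_of_summable_norm
    (summable_norm_theta (Or.inl rfl) hA0 (norm_pow_lt_one hq hA) one_ne_zero 0)
    (summable_norm_theta (Or.inl rfl) hB0 (norm_pow_lt_one hq hB) one_ne_zero 0), form]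
  refine tsum_congr fun p => ?_
  rw [one_zpow, one_zpow, one_mul, one_mul, ← zpow_natCast q A, ← zpow_natCast q B, ← zpow_mul,
    ← zpow_mul, ← zpow_add₀ hq0]
  congr 1
  push_cast
  ring

/-- If `4 C = A + B`, the vectors with even second coordinate in the lattice of `(A, A, C)` form the
lattice of `(A, 0, B)`, and those with odd second coordinate contribute a product of two series
`ψ`. -/
lemma form_eq_add_psi (hq0 : q ≠ 0) (hq : ‖q‖ < 1) {A B C : ℕ} (hA : A ≠ 0) (hB : B ≠ 0)
    (hC : 4 * C = A + B) :
    form A A C q = form A 0 B q + 4 * q ^ C * psi (q ^ (2 * A)) * psi (q ^ (2 * B)) := by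
  have hC' : 4 * (C : ℤ) = A + B := by exact_mod_cast hC
  have hs := (Equiv.prodComm ℤ ℤ).summable_iff.2 (summable_form hq0 hq (a := A) (c := C)
    (D := A * B) (b := A) hA (mul_ne_zero hA hB) (by push_cast; linear_combination (-(A : ℤ)) * hC'))
  rw [form, ← (Equiv.prodComm ℤ ℤ).tsum_eq]
  refine (tsum_eq_sum_residues hs two_ne_zero).trans ?_
  let e : ℤ × ℤ ≃ ℤ × ℤ :=
    { toFun := fun p => (p.2, p.1 - p.2)
      invFun := fun p => (p.1 + p.2, p.1)
      left_inv := fun p => by simp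
      right_inv := fun p => by simp }
  rw [Finset.sum_range_succ, Finset.sum_range_one]
  congr 1
  · rw [← e.tsum_eq, form]
    refine tsum_congr fun ⟨x, y⟩ => ?_
    change q ^ ((A : ℤ) * (x - y) ^ 2 + A * (x - y) * ((2 : ℕ) * y + (0 : ℕ)) +
      C * ((2 : ℕ) * y + (0 : ℕ)) ^ 2) = q ^ ((A : ℤ) * x ^ 2 + 0 * x * y + B * y ^ 2)
    congr 1
    push_cast
    linear_combination y ^ 2 * hC'
  · obtain ⟨w, hwq, hw0, hw⟩ := exists_root hq0 hq four_ne_zero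
    have hA0 := pow_ne_zero A hw0
    have hB0 := pow_ne_zero B hw0
    have hA1 := norm_pow_lt_one hw hA
    have hB1 := norm_pow_lt_one hw hB
    have h : theta 1 (w ^ A) 2 1 * theta 1 (w ^ B) 2 1 =
        4 * q ^ C * psi (q ^ (2 * A)) * psi (q ^ (2 * B)) := by
      rw [theta_two_one hA0 hA1, theta_two_one hB0 hB1, ← hwq, ← pow_mul, ← pow_mul, ← pow_mul,
        ← pow_mul, ← pow_mul, hC, pow_add, show 4 * (2 * A) = A * 8 by ring,
        show 4 * (2 * B) = B * 8 by ring]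
      ring
    rw [← h, theta, theta, tsum_mul_tsum_of_summable_norm
      (summable_norm_theta (Or.inl rfl) hA0 hA1 two_ne_zero 1)
      (summable_norm_theta (Or.inl rfl) hB0 hB1 two_ne_zero 1), ← e.tsum_eq]
    refine tsum_congr fun ⟨x, y⟩ => ?_
    change q ^ ((A : ℤ) * (x - y) ^ 2 + A * (x - y) * ((2 : ℕ) * y + (1 : ℕ)) +
      C * ((2 : ℕ) * y + (1 : ℕ)) ^ 2) = 1 ^ x * (w ^ A) ^ (((2 : ℕ) * x + 1) ^ 2) *
        (1 ^ y * (w ^ B) ^ (((2 : ℕ) * y + 1) ^ 2))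
    rw [one_zpow, one_zpow, one_mul, one_mul, ← hwq, ← zpow_natCast w A, ← zpow_natCast w B,
      ← zpow_natCast w 4, ← zpow_mul, ← zpow_mul, ← zpow_mul, ← zpow_add₀ hw0]
    congr 1
    push_cast
    linear_combination (2 * y + 1) ^ 2 * hC'

/-- The series `∑ s^m q^{2 n^2 + n m + 5 m^2}` over odd `n = 2 p.1 + 1` and all `m = p.2`. -/
noncomputable def oddSum (s q : ℂ) : ℂ :=
  ∑' p : ℤ × ℤ, s ^ p.2 * q ^ (2 * (2 * p.1 + 1) ^ 2 + (2 * p.1 + 1) * p.2 + 5 * p.2 ^ 2)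

lemma form_two_one_five (hq0 : q ≠ 0) (hq : ‖q‖ < 1) :
    form 2 1 5 q = form 5 2 8 q + oddSum 1 q := by
  have hs := summable_form hq0 hq (a := 2) (b := 1) (c := 5) (D := 39) two_ne_zero (by norm_num)
    (by norm_num)
  rw [form]
  refine (tsum_eq_sum_residues hs two_ne_zero).trans ?_
  rw [Finset.sum_range_succ, Finset.sum_range_one]
  congr 1
  · rw [form, ← (Equiv.prodComm ℤ ℤ).tsum_eq]
    refine tsum_congr fun ⟨x, y⟩ => ?_
    change q ^ (((2 : ℕ) : ℤ) * ((2 : ℕ) * y + (0 : ℕ)) ^ 2 + 1 * ((2 : ℕ) * y + (0 : ℕ)) * x +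
      (5 : ℕ) * x ^ 2) = q ^ (5 * x ^ 2 + 2 * x * y + 8 * y ^ 2)
    congr 1
    push_cast
    ring
  · rw [oddSum]
    refine tsum_congr fun p => ?_
    rw [one_zpow, one_mul]
    push_cast
    ring_nf

/-- Completing the square, `20 (2 x^2 + x y + 5 y^2)` is `X^2 + 39 Y^2` in the coordinates of
`tsum_rotate_ten` with `l = 1`. -/
lemma oddSum_pow_eq₁ {s w : ℂ} (hs : s = 1 ∨ s = -1) (hw0 : w ≠ 0) (hw : ‖w‖ < 1) :
    oddSum s (w ^ 20) = 2 * (theta s w 10 1 * theta s (w ^ 39) 10 1) +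
      2 * (theta s w 10 3 * theta s (w ^ 39) 10 3) + theta s w 10 5 * theta s (w ^ 39) 10 5 := by
  have h := tsum_rotate_ten hs hw0 hw (pow_ne_zero 39 hw0) (norm_pow_lt_one hw (by norm_num))
    odd_one
  rw [mul_one] at h
  rw [← h, oddSum]
  refine tsum_congr fun p => ?_
  rw [← zpow_natCast w 20, ← zpow_natCast w 39, ← zpow_mul, ← zpow_mul, ← zpow_add₀ hw0]
  congr 2
  push_cast
  ring

/-- After a shift of `x` by `y`, the form `20 (2 x^2 + x y + 5 y^2)` is also `3 X^2 + 13 Y^2` in the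
coordinates of `tsum_rotate_ten` with `l = 3`. -/
lemma oddSum_pow_eq₂ {s w : ℂ} (hs : s = 1 ∨ s = -1) (hw0 : w ≠ 0) (hw : ‖w‖ < 1) :
    oddSum s (w ^ 20) = 2 * (theta s (w ^ 3) 10 3 * theta s (w ^ 13) 10 1) +
      2 * s * (theta s (w ^ 3) 10 1 * theta s (w ^ 13) 10 3) +
      theta s (w ^ 3) 10 5 * theta s (w ^ 13) 10 5 := by
  have h := tsum_rotate_ten hs (pow_ne_zero 3 hw0) (norm_pow_lt_one hw three_ne_zero)
    (pow_ne_zero 13 hw0) (norm_pow_lt_one hw (by norm_num)) (l := 3) (by decide)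
  rw [show (3 : ℤ) * 3 = 9 by norm_num, theta_ten_nine hs] at h
  have h' : ∀ x y z : ℂ, 2 * s * (x * y) + z = 2 * (s * x * y) + z := fun x y z => by ring
  rw [add_assoc, h', ← add_assoc, ← h, oddSum]
  let e : ℤ × ℤ ≃ ℤ × ℤ :=
    { toFun := fun p => (p.1 - p.2, p.2)
      invFun := fun p => (p.1 + p.2, p.2)
      left_inv := fun p => by simp
      right_inv := fun p => by simp }
  conv_rhs => rw [← e.tsum_eq]
  refine tsum_congr fun ⟨x, y⟩ => ?_
  change s ^ y * (w ^ 20) ^ (2 * (2 * x + 1) ^ 2 + (2 * x + 1) * y + 5 * y ^ 2) =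
    s ^ y * ((w ^ 3) ^ ((3 * (2 * (x - y) + 1) + 10 * y) ^ 2) *
      (w ^ 13) ^ ((2 * (x - y) + 1) ^ 2))
  rw [← zpow_natCast w 20, ← zpow_natCast w 3, ← zpow_natCast w 13, ← zpow_mul, ← zpow_mul,
    ← zpow_mul, ← zpow_add₀ hw0]
  congr 2
  push_cast
  ring

lemma oddSum_eq₁ (hq0 : q ≠ 0) (hq : ‖q‖ < 1) :
    oddSum 1 q = 2 * q ^ 2 * (f (q ^ 4) (q ^ 6) * f (q ^ 156) (q ^ 234)) +
      2 * q ^ 18 * (f (q ^ 2) (q ^ 8) * f (q ^ 78) (q ^ 312)) +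
      4 * q ^ 50 * (psi (q ^ 10) * psi (q ^ 390)) := by
  obtain ⟨w, rfl, hw0, hw⟩ := exists_root hq0 hq (n := 20) (by norm_num)
  have h0 := pow_ne_zero 39 hw0
  rw [oddSum_pow_eq₁ (Or.inl rfl) hw0 hw, theta_ten_one hw0, theta_ten_one h0, theta_ten_three hw0,
    theta_ten_three h0, theta_ten_five hw0 hw, theta_ten_five h0 (norm_pow_lt_one hw (by norm_num))]
  simp only [← pow_mul]
  norm_num only
  ring

lemma oddSum_eq₂ (hq0 : q ≠ 0) (hq : ‖q‖ < 1) :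
    oddSum 1 q = 2 * q ^ 2 * (f (q ^ 6) (q ^ 24) * f (q ^ 52) (q ^ 78)) +
      2 * q ^ 6 * (f (q ^ 12) (q ^ 18) * f (q ^ 26) (q ^ 104)) +
      4 * q ^ 20 * (psi (q ^ 30) * psi (q ^ 130)) := by
  obtain ⟨w, rfl, hw0, hw⟩ := exists_root hq0 hq (n := 20) (by norm_num)
  have h0 := pow_ne_zero 3 hw0
  have h1 := pow_ne_zero 13 hw0
  rw [oddSum_pow_eq₂ (Or.inl rfl) hw0 hw, theta_ten_one h0, theta_ten_one h1, theta_ten_three h0,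
    theta_ten_three h1, theta_ten_five h0 (norm_pow_lt_one hw (by norm_num)),
    theta_ten_five h1 (norm_pow_lt_one hw (by norm_num))]
  simp only [← pow_mul]
  norm_num only
  ring

/-- The numerators of `U(1, 39)` and `U(3, 13)` agree: both represent the same signed sum over a
plane lattice. -/
theorem thetaG_thetaH_eq (hq0 : q ≠ 0) (hq : ‖q‖ < 1) :
    thetaG q * thetaG (q ^ 39) + q ^ 8 * (thetaH q * thetaH (q ^ 39)) =
      thetaH (q ^ 3) * thetaG (q ^ 13) - q ^ 2 * (thetaG (q ^ 3) * thetaH (q ^ 13)) := by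
  obtain ⟨w, rfl, hw0, hw⟩ := exists_root hq0 hq (n := 40) (by norm_num)
  have h39 := pow_ne_zero 39 hw0
  have h3 := pow_ne_zero 3 hw0
  have h13 := pow_ne_zero 13 hw0
  have h := (oddSum_pow_eq₁ (Or.inr rfl) hw0 hw).symm.trans (oddSum_pow_eq₂ (Or.inr rfl) hw0 hw)
  simp only [theta_neg_ten_five, zero_mul, add_zero] at h
  rw [theta_neg_ten_one hw0, theta_neg_ten_one h39, theta_neg_ten_one h3, theta_neg_ten_one h13,
    theta_neg_ten_three hw0, theta_neg_ten_three h39, theta_neg_ten_three h3,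
    theta_neg_ten_three h13] at h
  simp only [← pow_mul] at h ⊢
  norm_num only at h ⊢
  refine mul_left_cancel₀ (pow_ne_zero 40 hw0) ?_
  linear_combination h / 2

lemma form_five_two_eight₁ (hq0 : q ≠ 0) (hq : ‖q‖ < 1) :
    form 5 2 8 q = phi (q ^ 5) * phi (q ^ 195) +
      2 * q ^ 8 * (f (q ^ 3) (q ^ 7) * f (q ^ 117) (q ^ 273)) +
      2 * q ^ 32 * (f q (q ^ 9) * f (q ^ 39) (q ^ 351)) := by
  obtain ⟨w, rfl, hw0, hw⟩ := exists_root hq0 hq (n := 5) (by norm_num)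
  have h0 := pow_ne_zero 39 hw0
  have h := tsum_rotate_five hw0 hw h0 (norm_pow_lt_one hw (by norm_num)) 1
  rw [mul_one, theta_five_zero hw0, theta_five_zero h0, theta_five_one hw0, theta_five_one h0,
    theta_five_two hw0, theta_five_two h0] at h
  simp only [← pow_mul] at h ⊢
  norm_num only at h ⊢
  have h' : form 5 2 8 (w ^ 5) =
      ∑' p : ℤ × ℤ, w ^ ((1 * p.1 + 5 * p.2) ^ 2) * (w ^ 39) ^ (p.1 ^ 2) := by
    rw [form, ← (Equiv.prodComm ℤ ℤ).tsum_eq]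
    refine tsum_congr fun ⟨x, y⟩ => ?_
    change (w ^ 5) ^ (5 * y ^ 2 + 2 * y * x + 8 * x ^ 2) =
      w ^ ((1 * x + 5 * y) ^ 2) * (w ^ 39) ^ (x ^ 2)
    rw [← zpow_natCast w 5, ← zpow_natCast w 39, ← zpow_mul, ← zpow_mul, ← zpow_add₀ hw0]
    congr 1
    push_cast
    ring
  rw [h', h]
  ring

lemma form_five_two_eight₂ (hq0 : q ≠ 0) (hq : ‖q‖ < 1) :
    form 5 2 8 q = phi (q ^ 15) * phi (q ^ 65) +
      2 * q ^ 5 * (f (q ^ 3) (q ^ 27) * f (q ^ 39) (q ^ 91)) +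
      2 * q ^ 11 * (f (q ^ 9) (q ^ 21) * f (q ^ 13) (q ^ 117)) := by
  obtain ⟨w, rfl, hw0, hw⟩ := exists_root hq0 hq (n := 5) (by norm_num)
  have h0 := pow_ne_zero 3 hw0
  have h1 := pow_ne_zero 13 hw0
  have h := tsum_rotate_five h0 (norm_pow_lt_one hw three_ne_zero) h1
    (norm_pow_lt_one hw (by norm_num)) 3
  have e₃ : theta 1 (w ^ 3) 5 3 = theta 1 (w ^ 3) 5 2 := theta_five_neg_add 2 1
  have e₆ : theta 1 (w ^ 3) 5 (2 * 3) = theta 1 (w ^ 3) 5 1 := by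
    have h₁ := theta_five_neg_add (w := w ^ 3) (-6) (-1)
    have h₂ : (2 * 3 : ℤ) = -(-6) := by norm_num
    rw [h₂, theta_neg (Or.inl rfl), ← h₁]
    norm_num
  rw [e₃, e₆, theta_five_zero h0, theta_five_zero h1, theta_five_one h0, theta_five_one h1,
    theta_five_two h0, theta_five_two h1] at h
  simp only [← pow_mul] at h ⊢
  norm_num only at h ⊢
  have h' : form 5 2 8 (w ^ 5) =
      ∑' p : ℤ × ℤ, (w ^ 3) ^ ((3 * p.1 + 5 * p.2) ^ 2) * (w ^ 13) ^ (p.1 ^ 2) := by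
    let e : ℤ × ℤ ≃ ℤ × ℤ :=
      { toFun := fun p => (p.2 - p.1, p.1)
        invFun := fun p => (p.2, p.1 + p.2)
        left_inv := fun p => by simp
        right_inv := fun p => by simp }
    conv_rhs => rw [← e.tsum_eq]
    rw [form]
    refine tsum_congr fun ⟨x, y⟩ => ?_
    change (w ^ 5) ^ (5 * x ^ 2 + 2 * x * y + 8 * y ^ 2) =
      (w ^ 3) ^ ((3 * (y - x) + 5 * x) ^ 2) * (w ^ 13) ^ ((y - x) ^ 2)
    rw [← zpow_natCast w 5, ← zpow_natCast w 3, ← zpow_natCast w 13, ← zpow_mul, ← zpow_mul,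
      ← zpow_mul, ← zpow_add₀ hw0]
    congr 1
    push_cast
    ring
  rw [h', h]
  ring

/-! ### The products `G(q) G(q^4)` and `H(q) H(q^4)` -/

lemma phi_sq_eq (hq0 : q ≠ 0) (hq : ‖q‖ < 1) :
    phi q ^ 2 = phi (q ^ 5) ^ 2 + 4 * q * (f q (q ^ 9) * f (q ^ 3) (q ^ 7)) := by
  have hphi := form_diagonal hq0 hq one_ne_zero one_ne_zero
  rw [pow_one, ← pow_two] at hphi
  rw [← hphi]
  obtain ⟨w, rfl, hw0, hw⟩ := exists_root hq0 hq (n := 5) (by norm_num)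
  have h := tsum_rotate_five hw0 hw hw0 hw 2
  have e₄ : theta 1 w 5 (2 * 2) = theta 1 w 5 1 := theta_five_neg_add 1 1
  rw [e₄, theta_five_zero hw0, theta_five_one hw0, theta_five_two hw0] at h
  simp only [← pow_mul] at h ⊢
  norm_num only at h ⊢
  have h' : form 1 0 1 (w ^ 5) = ∑' p : ℤ × ℤ, w ^ ((2 * p.1 + 5 * p.2) ^ 2) * w ^ (p.1 ^ 2) := by
    let e : ℤ × ℤ ≃ ℤ × ℤ :=
      { toFun := fun p => (p.1 - 2 * p.2, p.2)
        invFun := fun p => (p.1 + 2 * p.2, p.2)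
        left_inv := fun p => by simp
        right_inv := fun p => by simp }
    conv_rhs => rw [← e.tsum_eq]
    rw [form]
    refine tsum_congr fun ⟨x, y⟩ => ?_
    change (w ^ 5) ^ (1 * x ^ 2 + 0 * x * y + 1 * y ^ 2) =
      w ^ ((2 * (x - 2 * y) + 5 * y) ^ 2) * w ^ ((x - 2 * y) ^ 2)
    rw [← zpow_natCast w 5, ← zpow_mul, ← zpow_add₀ hw0]
    congr 1
    push_cast
    ring
  rw [h', h]
  ring

lemma thetaG_mul_add_thetaH_mul (hq0 : q ≠ 0) (hq : ‖q‖ < 1) :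
    thetaG q * thetaG (q ^ 4) + q * (thetaH q * thetaH (q ^ 4)) = psi (-q) * phi q := by
  rw [← psi_mul_phi_neg_sq hq0 hq]
  obtain ⟨w, rfl, hw0, hw⟩ := exists_root hq0 hq (n := 40) (by norm_num)
  have h4 := pow_ne_zero 4 hw0
  have h5 := pow_ne_zero 5 hw0
  have h80 := pow_ne_zero 80 hw0
  have h51 := norm_pow_lt_one hw (n := 5) (by norm_num)
  have h801 := norm_pow_lt_one hw (n := 80) (by norm_num)
  have h := tsum_rotate_ten (s := -1) (Or.inr rfl) hw0 hw h4 (norm_pow_lt_one hw four_ne_zero)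
    odd_one
  have h' : ∑' p : ℤ × ℤ, (-1 : ℂ) ^ p.2 * (w ^ ((1 * (2 * p.1 + 1) + 10 * p.2) ^ 2) *
      (w ^ 4) ^ ((2 * p.1 + 1) ^ 2)) = theta 1 (w ^ 5) 2 1 * theta (-1) (w ^ 80) 1 0 := by
    let e : ℤ × ℤ ≃ ℤ × ℤ :=
      { toFun := fun p => (p.1 - p.2, p.2)
        invFun := fun p => (p.1 + p.2, p.2)
        left_inv := fun p => by simp
        right_inv := fun p => by simp }
    rw [theta, theta, tsum_mul_tsum_of_summable_norm
      (summable_norm_theta (Or.inl rfl) h5 h51 two_ne_zero 1)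
      (summable_norm_theta (Or.inr rfl) h80 h801 one_ne_zero 0), ← e.tsum_eq]
    refine tsum_congr fun ⟨x, y⟩ => ?_
    change (-1 : ℂ) ^ y * (w ^ ((1 * (2 * (x - y) + 1) + 10 * y) ^ 2) *
      (w ^ 4) ^ ((2 * (x - y) + 1) ^ 2)) = 1 ^ x * (w ^ 5) ^ (((2 : ℕ) * x + 1) ^ 2) *
        ((-1) ^ y * (w ^ 80) ^ (((1 : ℕ) * y + 0) ^ 2))
    have hexp : (1 * (2 * (x - y) + 1) + 10 * y) ^ 2 + (4 : ℕ) * (2 * (x - y) + 1) ^ 2 =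
        (5 : ℕ) * ((2 : ℕ) * x + 1) ^ 2 + (80 : ℕ) * ((1 : ℕ) * y + 0) ^ 2 := by
      push_cast
      ring
    rw [← zpow_natCast w 4, ← zpow_natCast w 5, ← zpow_natCast w 80, ← zpow_mul, ← zpow_mul,
      ← zpow_mul, ← zpow_add₀ hw0, hexp, zpow_add₀ hw0, one_zpow]
    ring
  rw [h', mul_one, theta_neg_ten_five, zero_mul, add_zero, theta_two_one h5 h51,
    theta_neg_one_zero h80, theta_neg_ten_one hw0, theta_neg_ten_one h4, theta_neg_ten_three hw0,
    theta_neg_ten_three h4] at h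
  simp only [← pow_mul] at h ⊢
  norm_num only at h ⊢
  refine mul_left_cancel₀ h5 ?_
  linear_combination -h / 2

end Forms

/-! ### Continuity on the unit disc -/

lemma f_zero_zero : f 0 0 = 1 := by
  rw [f, tsum_eq_single 0]
  · simp
  · intro n hn
    have h₁ : n * (n - 1) / 2 = tri n := rfl
    rw [h₁, mul_add_one_div_two]
    rcases eq_or_ne (tri n) 0 with h | h
    · rw [zero_zpow _ (by rwa [h, zero_add]), zero_mul]
    · rw [zero_zpow (tri n) h, mul_zero]

lemma tri_nonneg (n : ℤ) : 0 ≤ tri n := by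
  have h := two_mul_tri n
  rcases le_or_gt n 0 with hn | hn <;> nlinarith

/-- Continuity of `f(α(q), β(q))` on the unit disc, including the point `0`, when `α(q)` and `β(q)`
do not exceed `q` in absolute value. -/
lemma continuousOn_f {α β : ℂ → ℂ} (hα : Continuous α) (hβ : Continuous β)
    (hα' : ∀ q, ‖q‖ < 1 → ‖α q‖ ≤ ‖q‖) (hβ' : ∀ q, ‖q‖ < 1 → ‖β q‖ ≤ ‖q‖) :
    ContinuousOn (fun q => f (α q) (β q)) (Metric.ball 0 1) := by
  have hnn : ∀ n : ℤ, 0 ≤ tri n + n := fun n => by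
    rw [← tri_add_one]
    exact tri_nonneg _
  intro q hq
  rw [mem_ball_zero_iff] at hq
  obtain ⟨ρ, hqρ, hρ⟩ := exists_between hq
  have hρ0 : 0 < ρ := (norm_nonneg q).trans_lt hqρ
  have hρc : ‖(ρ : ℂ)‖ = ρ := by rw [Complex.norm_real, Real.norm_of_nonneg hρ0.le]
  have hball : ContinuousOn (fun q => f (α q) (β q)) (Metric.ball 0 ρ) := by
    refine continuousOn_tsum (u := fun n : ℤ => ‖(ρ : ℂ) ^ (n ^ 2)‖) (fun n => ?_)
      (summable_norm_sq (by exact_mod_cast hρ0.ne') (by rwa [hρc])) (fun n x hx => ?_)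
    · refine ContinuousOn.mul ?_ ?_
      · exact hα.continuousOn.zpow₀ _ fun x _ => Or.inr (by rw [mul_add_one_div_two]; exact hnn n)
      · exact hβ.continuousOn.zpow₀ _ fun x _ => Or.inr (tri_nonneg n)
    · rw [mem_ball_zero_iff] at hx
      have hx1 : ‖x‖ < 1 := hx.trans hρ
      rw [norm_mul, norm_zpow, norm_zpow, norm_zpow, hρc,
        mul_add_one_div_two, ← tri]
      calc ‖α x‖ ^ (tri n + n) * ‖β x‖ ^ tri n ≤ ρ ^ (tri n + n) * ρ ^ tri n :=
            mul_le_mul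
              (zpow_le_zpow_left₀ (hnn n) (norm_nonneg _) ((hα' x hx1).trans hx.le))
              (zpow_le_zpow_left₀ (tri_nonneg n) (norm_nonneg _) ((hβ' x hx1).trans hx.le))
              (zpow_nonneg (norm_nonneg _) _) (zpow_nonneg hρ0.le _)
        _ = ρ ^ (n ^ 2) := by
            rw [← zpow_add₀ hρ0.ne', show tri n + n + tri n = n ^ 2 by
              have := two_mul_tri n
              linarith]
  exact (hball.continuousAt (Metric.isOpen_ball.mem_nhds (by simpa using hqρ))).continuousWithinAt

lemma norm_pow_le {q : ℂ} (hq : ‖q‖ < 1) {n : ℕ} (hn : n ≠ 0) : ‖q ^ n‖ ≤ ‖q‖ := by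
  rw [norm_pow]
  exact pow_le_of_le_one (norm_nonneg q) hq.le hn

lemma continuousOn_thetaG : ContinuousOn thetaG (Metric.ball 0 1) := by
  refine continuousOn_f (by fun_prop) (by fun_prop) (fun q hq => ?_) (fun q hq => ?_)
  · rw [norm_neg]; exact norm_pow_le hq two_ne_zero
  · rw [norm_neg]; exact norm_pow_le hq three_ne_zero

lemma continuousOn_thetaH : ContinuousOn thetaH (Metric.ball 0 1) := by
  refine continuousOn_f (by fun_prop) (by fun_prop) (fun q hq => ?_) (fun q hq => ?_)
  · rw [norm_neg]
  · rw [norm_neg]; exact norm_pow_le hq four_ne_zero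

lemma continuousOn_phi : ContinuousOn phi (Metric.ball 0 1) :=
  continuousOn_f continuous_id continuous_id (fun _ _ => le_rfl) (fun _ _ => le_rfl)

lemma continuousOn_psi : ContinuousOn psi (Metric.ball 0 1) :=
  continuousOn_f continuous_id (by fun_prop) (fun _ _ => le_rfl)
    (fun _ hq => norm_pow_le hq three_ne_zero)

lemma mapsTo_pow_ball {n : ℕ} (hn : n ≠ 0) :
    Set.MapsTo (fun q : ℂ => q ^ n) (Metric.ball 0 1) (Metric.ball 0 1) := by
  intro q hq
  rw [mem_ball_zero_iff] at hq ⊢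
  exact norm_pow_lt_one hq hn

lemma mapsTo_neg_ball : Set.MapsTo (fun q : ℂ => -q) (Metric.ball 0 1) (Metric.ball 0 1) := by
  intro q hq
  rw [mem_ball_zero_iff] at hq ⊢
  rwa [norm_neg]

lemma thetaG_zero : thetaG 0 = 1 := by simp [thetaG, f_zero_zero]

lemma psi_zero : psi 0 = 1 := by simp [psi, f_zero_zero]

lemma phi_zero : phi 0 = 1 := f_zero_zero

lemma phi_ne_zero {q : ℂ} (hq0 : q ≠ 0) (hq : ‖q‖ < 1) : phi q ≠ 0 := by
  have h : q * q = q ^ 2 := (pow_two q).symm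
  have h2 := norm_pow_lt_one hq two_ne_zero
  have hn : ‖-q‖ < 1 := by rwa [norm_neg]
  rw [phi, f_eq_qProd hq0 hq0 (by rwa [h]), h]
  exact mul_ne_zero (mul_ne_zero (qProd_ne_zero hn h2) (qProd_ne_zero hn h2)) (qProd_ne_zero h2 h2)

/-- The companion of `thetaG_mul_add_thetaH_mul`. The squares of both sides agree, since the sum of
the two terms on the left and their product are known; the right-hand side has no zero in the unit
disc, so by connectedness the sign is that at `q = 0`. -/
theorem thetaG_mul_sub_thetaH_mul {q : ℂ} (hq : ‖q‖ < 1) :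
    thetaG q * thetaG (q ^ 4) - q * (thetaH q * thetaH (q ^ 4)) = psi (-q) * phi (q ^ 5) := by
  have hpow : ∀ n : ℕ, ContinuousOn (fun q : ℂ => q ^ n) (Metric.ball 0 1) := fun n =>
    (continuous_pow n).continuousOn
  have hL : ContinuousOn (fun q => thetaG q * thetaG (q ^ 4) - q * (thetaH q * thetaH (q ^ 4)))
      (Metric.ball 0 1) :=
    (continuousOn_thetaG.mul (continuousOn_thetaG.comp (hpow 4) (mapsTo_pow_ball four_ne_zero))).sub
      (continuousOn_id.mul (continuousOn_thetaH.mul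
        (continuousOn_thetaH.comp (hpow 4) (mapsTo_pow_ball four_ne_zero))))
  have hR : ContinuousOn (fun q => psi (-q) * phi (q ^ 5)) (Metric.ball 0 1) :=
    (continuousOn_psi.comp continuous_neg.continuousOn mapsTo_neg_ball).mul
      (continuousOn_phi.comp (hpow 5) (mapsTo_pow_ball (by norm_num)))
  have h0 : thetaG 0 * thetaG (0 ^ 4) - 0 * (thetaH 0 * thetaH (0 ^ 4)) =
      psi (-0) * phi (0 ^ 5) := by simp [thetaG_zero, psi_zero, phi_zero]
  refine Metric.isPreconnected_ball.eq_of_sq_eq hL hR (fun x hx => ?_) (fun {x} hx => ?_)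
    (Metric.mem_ball_self zero_lt_one) h0 (mem_ball_zero_iff.2 hq)
  · rw [mem_ball_zero_iff] at hx
    rcases eq_or_ne x 0 with rfl | hx0
    · exact congrArg (· ^ 2) h0
    · have h₁ := thetaG_mul_add_thetaH_mul hx0 hx
      have h₂ := thetaG_mul_thetaH_pow_four hx0 hx
      have h₃ := thetaH_mul_thetaG_pow_four hx0 hx
      have h₄ := phi_sq_eq hx0 hx
      rw [pow_one] at h₂
      simp only [Pi.pow_apply]
      calc (thetaG x * thetaG (x ^ 4) - x * (thetaH x * thetaH (x ^ 4))) ^ 2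
          = (thetaG x * thetaG (x ^ 4) + x * (thetaH x * thetaH (x ^ 4))) ^ 2 -
            4 * x * (thetaG x * thetaH (x ^ 4)) * (thetaH x * thetaG (x ^ 4)) := by ring
        _ = (psi (-x) * phi (x ^ 5)) ^ 2 := by
            rw [h₁, h₂, h₃]
            linear_combination psi (-x) ^ 2 * h₄
  · rw [mem_ball_zero_iff] at hx
    rcases eq_or_ne x 0 with rfl | hx0
    · simp [psi_zero, phi_zero]
    · exact mul_ne_zero (psi_neg_ne_zero hx0 hx)
        (phi_ne_zero (pow_ne_zero 5 hx0) (norm_pow_lt_one hx (by norm_num)))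

/-! ### Products of two Rogers--Ramanujan functions -/

section RogersRamanujan

variable {q : ℂ}

lemma mul_E_cancel_neg (hq0 : q ≠ 0) (hq : ‖q‖ < 1) {A B a b T : ℂ} (hA : A * E q = a)
    (hB : B * E (-q) = b) (h : a * b = phi (-q ^ 2) * T) : E (q ^ 2) * (A * B) = T := by
  refine mul_left_cancel₀ (phi_neg_sq_ne_zero hq0 hq) ?_
  rw [← h, ← hA, ← hB]
  linear_combination (A * B) * E_mul_E_neg hq0 hq

lemma mul_E_cancel_four (hq0 : q ≠ 0) (hq : ‖q‖ < 1) {A B a b T : ℂ} (hA : A * E q = a)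
    (hB : B * E (q ^ 4) = b) (h : a * b = psi (-q) * T) : E (q ^ 2) * (A * B) = T := by
  refine mul_left_cancel₀ (psi_neg_ne_zero hq0 hq) ?_
  rw [← h, ← hA, ← hB]
  linear_combination (A * B) * psi_neg_mul_E hq0 hq

lemma G_mul_E_neg (hq0 : q ≠ 0) (hq : ‖q‖ < 1) : G (-q) * E (-q) = thetaG (-q) :=
  G_mul_E (neg_ne_zero.2 hq0) (by rwa [norm_neg])

lemma H_mul_E_neg (hq0 : q ≠ 0) (hq : ‖q‖ < 1) : H (-q) * E (-q) = thetaH (-q) :=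
  H_mul_E (neg_ne_zero.2 hq0) (by rwa [norm_neg])

lemma E_mul_G_mul_G_neg (hq0 : q ≠ 0) (hq : ‖q‖ < 1) :
    E (q ^ 2) * (G q * G (-q)) = f (q ^ 4) (q ^ 6) :=
  mul_E_cancel_neg hq0 hq (G_mul_E hq0 hq) (G_mul_E_neg hq0 hq) (thetaG_mul_thetaG_neg hq0 hq)

lemma E_mul_H_mul_H_neg (hq0 : q ≠ 0) (hq : ‖q‖ < 1) :
    E (q ^ 2) * (H q * H (-q)) = f (q ^ 2) (q ^ 8) :=
  mul_E_cancel_neg hq0 hq (H_mul_E hq0 hq) (H_mul_E_neg hq0 hq) (thetaH_mul_thetaH_neg hq0 hq)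

lemma E_mul_G_mul_H_neg (hq0 : q ≠ 0) (hq : ‖q‖ < 1) :
    E (q ^ 2) * (G q * H (-q)) = psi (q ^ 2) + q * psi (q ^ 10) :=
  mul_E_cancel_neg hq0 hq (G_mul_E hq0 hq) (H_mul_E_neg hq0 hq) (thetaG_mul_thetaH_neg hq0 hq)

lemma E_mul_H_mul_G_neg (hq0 : q ≠ 0) (hq : ‖q‖ < 1) :
    E (q ^ 2) * (H q * G (-q)) = psi (q ^ 2) - q * psi (q ^ 10) := by
  have h := E_mul_G_mul_H_neg (neg_ne_zero.2 hq0) (by rwa [norm_neg])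
  rw [neg_neg, neg_sq, Even.neg_pow (by decide : Even 10)] at h
  rw [mul_comm (H q), h]
  ring

lemma E_mul_G_mul_H_pow_four (hq0 : q ≠ 0) (hq : ‖q‖ < 1) :
    E (q ^ 2) * (G q * H (q ^ 4)) = f q (q ^ 9) := by
  have h := thetaG_mul_thetaH_pow_four hq0 hq
  rw [pow_one] at h
  exact mul_E_cancel_four hq0 hq (G_mul_E hq0 hq)
    (H_mul_E (pow_ne_zero 4 hq0) (norm_pow_lt_one hq four_ne_zero)) h

lemma E_mul_H_mul_G_pow_four (hq0 : q ≠ 0) (hq : ‖q‖ < 1) :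
    E (q ^ 2) * (H q * G (q ^ 4)) = f (q ^ 3) (q ^ 7) :=
  mul_E_cancel_four hq0 hq (H_mul_E hq0 hq)
    (G_mul_E (pow_ne_zero 4 hq0) (norm_pow_lt_one hq four_ne_zero))
    (thetaH_mul_thetaG_pow_four hq0 hq)

lemma E_mul_G_mul_G_pow_four (hq0 : q ≠ 0) (hq : ‖q‖ < 1) :
    E (q ^ 2) * (G q * G (q ^ 4)) = (phi q + phi (q ^ 5)) / 2 := by
  refine mul_E_cancel_four hq0 hq (G_mul_E hq0 hq)
    (G_mul_E (pow_ne_zero 4 hq0) (norm_pow_lt_one hq four_ne_zero)) ?_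
  linear_combination (thetaG_mul_add_thetaH_mul hq0 hq + thetaG_mul_sub_thetaH_mul hq) / 2

lemma E_mul_H_mul_H_pow_four (hq0 : q ≠ 0) (hq : ‖q‖ < 1) :
    q * (E (q ^ 2) * (H q * H (q ^ 4))) = (phi q - phi (q ^ 5)) / 2 := by
  have h := mul_E_cancel_four hq0 hq (T := (phi q - phi (q ^ 5)) / 2) (A := q * H q)
    (by rw [mul_assoc, H_mul_E hq0 hq])
    (H_mul_E (pow_ne_zero 4 hq0) (norm_pow_lt_one hq four_ne_zero)) (by
      linear_combination (thetaG_mul_add_thetaH_mul hq0 hq - thetaG_mul_sub_thetaH_mul hq) / 2)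
  rw [← h]
  ring

/-! ### The functions `U(1, 39)` and `U(3, 13)` -/

lemma U_one_thirtynine (q : ℂ) : U 1 39 q = G q * G (q ^ 39) + q ^ 8 * (H q * H (q ^ 39)) := by
  rw [U, if_pos (by decide), pow_one]
  norm_num only
  ring

lemma U_three_thirteen (q : ℂ) :
    U 3 13 q = H (q ^ 3) * G (q ^ 13) - q ^ 2 * (G (q ^ 3) * H (q ^ 13)) := by
  rw [U, if_neg (by decide), if_pos (by decide)]
  have h : ((13 : ℕ) - (3 : ℕ) : ℤ) / 5 = (2 : ℕ) := by norm_num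
  rw [h, zpow_natCast]
  ring

lemma E_mul_U_one_thirtynine (hq0 : q ≠ 0) (hq : ‖q‖ < 1) :
    E q * E (q ^ 39) * U 1 39 q =
      thetaG q * thetaG (q ^ 39) + q ^ 8 * (thetaH q * thetaH (q ^ 39)) := by
  have h0 := pow_ne_zero 39 hq0
  have h1 := norm_pow_lt_one hq (n := 39) (by norm_num)
  rw [U_one_thirtynine, ← G_mul_E hq0 hq, ← H_mul_E hq0 hq, ← G_mul_E h0 h1, ← H_mul_E h0 h1]
  ring

/-- The relation between `U(1, 39)` and `U(3, 13)`. -/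
lemma E_mul_U_eq (hq0 : q ≠ 0) (hq : ‖q‖ < 1) :
    E q * E (q ^ 39) * U 1 39 q = E (q ^ 3) * E (q ^ 13) * U 3 13 q := by
  have h0 := pow_ne_zero 3 hq0
  have h1 := norm_pow_lt_one hq (n := 3) (by norm_num)
  have h0' := pow_ne_zero 13 hq0
  have h1' := norm_pow_lt_one hq (n := 13) (by norm_num)
  rw [E_mul_U_one_thirtynine hq0 hq, thetaG_thetaH_eq hq0 hq, U_three_thirteen, ← G_mul_E h0 h1,
    ← H_mul_E h0 h1, ← G_mul_E h0' h1', ← H_mul_E h0' h1']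
  ring

lemma U_one_thirtynine_mul_neg (hq0 : q ≠ 0) (hq : ‖q‖ < 1) :
    2 * q ^ 2 * E (q ^ 2) * E (q ^ 78) * U 1 39 q * U 1 39 (-q) =
      form 1 1 10 q + form 2 1 5 q - form 1 0 39 q - form 5 2 8 q := by
  have h0 := pow_ne_zero 39 hq0
  have h1 := norm_pow_lt_one hq (n := 39) (by norm_num)
  have hA := form_eq_add_psi hq0 hq (A := 1) (B := 39) (C := 10) (by norm_num) (by norm_num)
    (by norm_num)
  have a' := E_mul_G_mul_G_neg h0 h1
  have b' := E_mul_H_mul_H_neg h0 h1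
  have c' := E_mul_G_mul_H_neg h0 h1
  have d' := E_mul_H_mul_G_neg h0 h1
  simp only [← pow_mul] at a' b' c' d'
  norm_num only [Nat.cast_one, Nat.cast_ofNat] at a' b' c' d' hA
  have hL : 2 * q ^ 2 * E (q ^ 2) * E (q ^ 78) * U 1 39 q * U 1 39 (-q) = 2 * q ^ 2 *
      (E (q ^ 2) * (G q * G (-q)) * (E (q ^ 78) * (G (q ^ 39) * G (-q ^ 39))) +
        q ^ 16 * (E (q ^ 2) * (H q * H (-q)) * (E (q ^ 78) * (H (q ^ 39) * H (-q ^ 39)))) +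
        q ^ 8 * (E (q ^ 2) * (G q * H (-q)) * (E (q ^ 78) * (G (q ^ 39) * H (-q ^ 39))) +
          E (q ^ 2) * (H q * G (-q)) * (E (q ^ 78) * (H (q ^ 39) * G (-q ^ 39))))) := by
    rw [U_one_thirtynine, U_one_thirtynine, Odd.neg_pow (by decide : Odd 39)]
    ring
  rw [hL, E_mul_G_mul_G_neg hq0 hq, E_mul_H_mul_H_neg hq0 hq, E_mul_G_mul_H_neg hq0 hq,
    E_mul_H_mul_G_neg hq0 hq, a', b', c', d', hA, form_two_one_five hq0 hq, oddSum_eq₁ hq0 hq]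
  ring

lemma U_three_thirteen_mul_neg (hq0 : q ≠ 0) (hq : ‖q‖ < 1) :
    2 * q ^ 2 * E (q ^ 6) * E (q ^ 26) * U 3 13 q * U 3 13 (-q) =
      form 3 0 13 q + form 2 1 5 q - form 3 3 4 q - form 5 2 8 q := by
  have h0 := pow_ne_zero 3 hq0
  have h1 := norm_pow_lt_one hq (n := 3) (by norm_num)
  have h0' := pow_ne_zero 13 hq0
  have h1' := norm_pow_lt_one hq (n := 13) (by norm_num)
  have hA := form_eq_add_psi hq0 hq (A := 3) (B := 13) (C := 4) (by norm_num) (by norm_num)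
    (by norm_num)
  have a := E_mul_G_mul_G_neg h0 h1
  have b := E_mul_H_mul_H_neg h0 h1
  have c := E_mul_G_mul_H_neg h0 h1
  have d := E_mul_H_mul_G_neg h0 h1
  have a' := E_mul_G_mul_G_neg h0' h1'
  have b' := E_mul_H_mul_H_neg h0' h1'
  have c' := E_mul_G_mul_H_neg h0' h1'
  have d' := E_mul_H_mul_G_neg h0' h1'
  simp only [← pow_mul] at a b c d a' b' c' d'
  norm_num only [Nat.cast_one, Nat.cast_ofNat] at a b c d a' b' c' d' hA
  have hL : 2 * q ^ 2 * E (q ^ 6) * E (q ^ 26) * U 3 13 q * U 3 13 (-q) = 2 * q ^ 2 *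
      (E (q ^ 6) * (H (q ^ 3) * H (-q ^ 3)) * (E (q ^ 26) * (G (q ^ 13) * G (-q ^ 13))) +
        q ^ 4 * (E (q ^ 6) * (G (q ^ 3) * G (-q ^ 3)) *
          (E (q ^ 26) * (H (q ^ 13) * H (-q ^ 13)))) -
        q ^ 2 * (E (q ^ 6) * (H (q ^ 3) * G (-q ^ 3)) *
            (E (q ^ 26) * (G (q ^ 13) * H (-q ^ 13))) +
          E (q ^ 6) * (G (q ^ 3) * H (-q ^ 3)) *
            (E (q ^ 26) * (H (q ^ 13) * G (-q ^ 13))))) := by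
    rw [U_three_thirteen, U_three_thirteen, Odd.neg_pow (by decide : Odd 3),
      Odd.neg_pow (by decide : Odd 13)]
    ring
  rw [hL, a, b, c, d, a', b', c', d', hA, form_two_one_five hq0 hq, oddSum_eq₂ hq0 hq]
  ring

lemma U_one_thirtynine_mul_pow_four (hq0 : q ≠ 0) (hq : ‖q‖ < 1) :
    2 * (E (q ^ 2) * E (q ^ 78) * (U 1 39 q * U 1 39 (q ^ 4))) =
      form 1 0 39 q + form 5 2 8 q := by
  have h0 := pow_ne_zero 39 hq0
  have h1 := norm_pow_lt_one hq (n := 39) (by norm_num)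
  have hA := form_diagonal hq0 hq (A := 1) (B := 39) (by norm_num) (by norm_num)
  have a' := E_mul_G_mul_G_pow_four h0 h1
  have b' := E_mul_H_mul_H_pow_four h0 h1
  have c' := E_mul_G_mul_H_pow_four h0 h1
  have d' := E_mul_H_mul_G_pow_four h0 h1
  simp only [← pow_mul] at a' b' c' d'
  norm_num only [Nat.cast_one, Nat.cast_ofNat, pow_one] at a' b' c' d' hA
  have hL : 2 * (E (q ^ 2) * E (q ^ 78) * (U 1 39 q * U 1 39 (q ^ 4))) = 2 *
      (E (q ^ 2) * (G q * G (q ^ 4)) * (E (q ^ 78) * (G (q ^ 39) * G (q ^ 156))) +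
        q * (E (q ^ 2) * (H q * H (q ^ 4))) *
          (q ^ 39 * (E (q ^ 78) * (H (q ^ 39) * H (q ^ 156)))) +
        q ^ 32 * (E (q ^ 2) * (G q * H (q ^ 4)) * (E (q ^ 78) * (G (q ^ 39) * H (q ^ 156)))) +
        q ^ 8 * (E (q ^ 2) * (H q * G (q ^ 4)) *
          (E (q ^ 78) * (H (q ^ 39) * G (q ^ 156))))) := by
    rw [U_one_thirtynine, U_one_thirtynine, ← pow_mul]
    norm_num only
    ring
  rw [hL, E_mul_G_mul_G_pow_four hq0 hq, E_mul_H_mul_H_pow_four hq0 hq,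
    E_mul_G_mul_H_pow_four hq0 hq, E_mul_H_mul_G_pow_four hq0 hq, a', b', c', d', hA,
    form_five_two_eight₁ hq0 hq]
  ring

lemma U_three_thirteen_mul_pow_four (hq0 : q ≠ 0) (hq : ‖q‖ < 1) :
    2 * q ^ 3 * (E (q ^ 6) * E (q ^ 26) * (U 3 13 q * U 3 13 (q ^ 4))) =
      form 3 0 13 q - form 5 2 8 q := by
  have h0 := pow_ne_zero 3 hq0
  have h1 := norm_pow_lt_one hq (n := 3) (by norm_num)
  have h0' := pow_ne_zero 13 hq0
  have h1' := norm_pow_lt_one hq (n := 13) (by norm_num)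
  have hA := form_diagonal hq0 hq (A := 3) (B := 13) (by norm_num) (by norm_num)
  have a := E_mul_G_mul_G_pow_four h0 h1
  have b := E_mul_H_mul_H_pow_four h0 h1
  have c := E_mul_G_mul_H_pow_four h0 h1
  have d := E_mul_H_mul_G_pow_four h0 h1
  have a' := E_mul_G_mul_G_pow_four h0' h1'
  have b' := E_mul_H_mul_H_pow_four h0' h1'
  have c' := E_mul_G_mul_H_pow_four h0' h1'
  have d' := E_mul_H_mul_G_pow_four h0' h1'
  simp only [← pow_mul] at a b c d a' b' c' d'
  norm_num only [Nat.cast_one, Nat.cast_ofNat, pow_one] at a b c d a' b' c' d' hA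
  have hL : 2 * q ^ 3 * (E (q ^ 6) * E (q ^ 26) * (U 3 13 q * U 3 13 (q ^ 4))) =
      2 * (q ^ 3 * (E (q ^ 6) * (H (q ^ 3) * H (q ^ 12))) *
          (E (q ^ 26) * (G (q ^ 13) * G (q ^ 52))) +
        E (q ^ 6) * (G (q ^ 3) * G (q ^ 12)) *
          (q ^ 13 * (E (q ^ 26) * (H (q ^ 13) * H (q ^ 52))))) -
      2 * q ^ 11 * (E (q ^ 6) * (H (q ^ 3) * G (q ^ 12)) *
          (E (q ^ 26) * (G (q ^ 13) * H (q ^ 52)))) -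
      2 * q ^ 5 * (E (q ^ 6) * (G (q ^ 3) * H (q ^ 12)) *
          (E (q ^ 26) * (H (q ^ 13) * G (q ^ 52)))) := by
    rw [U_three_thirteen, U_three_thirteen, ← pow_mul, ← pow_mul]
    norm_num only
    ring
  rw [hL, a, b, c, d, a', b', c', d', hA, form_five_two_eight₂ hq0 hq]
  ring

/-! ### The quotients -/

/-- Together with `psi_mul_form'`, this expresses both sides of the first quotient through
`E(q) E(q^39) U(1, 39, q)` and `E(q^3) E(q^13) U(3, 13, q)`, which are equal. -/
lemma psi_mul_form (hq0 : q ≠ 0) (hq : ‖q‖ < 1) :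
    psi (-q) * psi (-q ^ 39) * (form 1 0 39 q + form 5 2 8 q) =
      2 * ((E q * E (q ^ 39) * U 1 39 q) *
        (E (q ^ 4) * E ((q ^ 4) ^ 39) * U 1 39 (q ^ 4))) := by
  have h₁ := psi_neg_mul_E hq0 hq
  have h₂ := psi_neg_mul_E (pow_ne_zero 39 hq0) (norm_pow_lt_one hq (by norm_num))
  simp only [← pow_mul] at h₂ ⊢
  norm_num only at h₂ ⊢
  rw [← U_one_thirtynine_mul_pow_four hq0 hq]
  linear_combination (2 * (U 1 39 q * U 1 39 (q ^ 4)) * (psi (-q ^ 39) * E (q ^ 78))) * h₁ +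
    (2 * (U 1 39 q * U 1 39 (q ^ 4)) * (E q * E (q ^ 4))) * h₂

lemma psi_mul_form' (hq0 : q ≠ 0) (hq : ‖q‖ < 1) :
    psi (-q ^ 3) * psi (-q ^ 13) * (form 3 0 13 q - form 5 2 8 q) =
      2 * q ^ 3 * ((E (q ^ 3) * E (q ^ 13) * U 3 13 q) *
        (E ((q ^ 4) ^ 3) * E ((q ^ 4) ^ 13) * U 3 13 (q ^ 4))) := by
  have h₁ := psi_neg_mul_E (pow_ne_zero 3 hq0) (norm_pow_lt_one hq (by norm_num))
  have h₂ := psi_neg_mul_E (pow_ne_zero 13 hq0) (norm_pow_lt_one hq (by norm_num))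
  simp only [← pow_mul] at h₁ h₂ ⊢
  norm_num only at h₁ h₂ ⊢
  rw [← U_three_thirteen_mul_pow_four hq0 hq]
  linear_combination
    (2 * q ^ 3 * (U 3 13 q * U 3 13 (q ^ 4)) * (psi (-q ^ 13) * E (q ^ 26))) * h₁ +
    (2 * q ^ 3 * (U 3 13 q * U 3 13 (q ^ 4)) * (E (q ^ 3) * E (q ^ 12))) * h₂

/-- The analogue of `psi_mul_form` for the second quotient, with `-q` in place of `q^4`. -/
lemma phi_mul_form (hq0 : q ≠ 0) (hq : ‖q‖ < 1) :
    phi (-q ^ 2) * phi (-q ^ 78) *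
        (form 1 1 10 q + form 2 1 5 q - form 1 0 39 q - form 5 2 8 q) =
      2 * q ^ 2 * ((E q * E (q ^ 39) * U 1 39 q) *
        (E (-q) * E ((-q) ^ 39) * U 1 39 (-q))) := by
  have h₁ := E_mul_E_neg hq0 hq
  have h₂ := E_mul_E_neg (pow_ne_zero 39 hq0) (norm_pow_lt_one hq (by norm_num))
  simp only [← pow_mul] at h₂
  norm_num only at h₂
  rw [← U_one_thirtynine_mul_neg hq0 hq, Odd.neg_pow (by decide : Odd 39)]
  linear_combination
    (2 * q ^ 2 * (U 1 39 q * U 1 39 (-q)) * (phi (-q ^ 78) * E (q ^ 78))) * h₁ +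
    (2 * q ^ 2 * (U 1 39 q * U 1 39 (-q)) * (E q * E (-q))) * h₂

lemma phi_mul_form' (hq0 : q ≠ 0) (hq : ‖q‖ < 1) :
    phi (-q ^ 6) * phi (-q ^ 26) *
        (form 3 0 13 q + form 2 1 5 q - form 3 3 4 q - form 5 2 8 q) =
      2 * q ^ 2 * ((E (q ^ 3) * E (q ^ 13) * U 3 13 q) *
        (E ((-q) ^ 3) * E ((-q) ^ 13) * U 3 13 (-q))) := by
  have h₁ := E_mul_E_neg (pow_ne_zero 3 hq0) (norm_pow_lt_one hq (by norm_num))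
  have h₂ := E_mul_E_neg (pow_ne_zero 13 hq0) (norm_pow_lt_one hq (by norm_num))
  simp only [← pow_mul] at h₁ h₂
  norm_num only at h₁ h₂
  rw [← U_three_thirteen_mul_neg hq0 hq, Odd.neg_pow (by decide : Odd 3),
    Odd.neg_pow (by decide : Odd 13)]
  linear_combination
    (2 * q ^ 2 * (U 3 13 q * U 3 13 (-q)) * (phi (-q ^ 26) * E (q ^ 26))) * h₁ +
    (2 * q ^ 2 * (U 3 13 q * U 3 13 (-q)) * (E (q ^ 3) * E (-q ^ 3))) * h₂

lemma form_zero {a b c : ℤ} (ha : 0 < a) (hD : b ^ 2 < 4 * a * c) : form a b c 0 = 1 := by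
  rw [form, tsum_eq_single (0, 0)]
  · simp
  · rintro ⟨x, y⟩ hxy
    refine zero_zpow _ fun h => hxy ?_
    simp only at h
    have h₁ : (2 * a * x + b * y) ^ 2 + (4 * a * c - b ^ 2) * y ^ 2 = 0 := by
      linear_combination 4 * a * h
    have hy : y = 0 := by
      by_contra hy
      have : 0 < y ^ 2 := by positivity
      nlinarith [sq_nonneg (2 * a * x + b * y)]
    subst hy
    have hx : a * x ^ 2 = 0 := by linear_combination h
    have hx' : x = 0 := by
      rcases mul_eq_zero.1 hx with h | h
      · exact absurd h ha.ne'
      · exact pow_eq_zero_iff two_ne_zero |>.1 h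
    rw [hx']

/-- Both denominators are non-zero near `0`, as the function `E(q) E(q^39) U(1, 39)` is continuous
and equal to `1` at `0`. -/
lemma eventually_forms_ne_zero : ∀ᶠ q : ℂ in 𝓝[≠] 0,
    form 1 0 39 q + form 5 2 8 q ≠ 0 ∧
      form 3 0 13 q + form 2 1 5 q - form 3 3 4 q - form 5 2 8 q ≠ 0 := by
  set n : ℂ → ℂ := fun q => thetaG q * thetaG (q ^ 39) + q ^ 8 * (thetaH q * thetaH (q ^ 39)) with hn
  have hball : Metric.ball (0 : ℂ) 1 ∈ 𝓝 0 := Metric.ball_mem_nhds 0 zero_lt_one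
  have hpow := fun n : ℕ => (continuous_pow (M := ℂ) n).continuousOn (s := Metric.ball 0 1)
  have hcont : ContinuousOn n (Metric.ball 0 1) :=
    (continuousOn_thetaG.mul (continuousOn_thetaG.comp (hpow 39) (mapsTo_pow_ball (by norm_num)))).add
      ((hpow 8).mul (continuousOn_thetaH.mul
        (continuousOn_thetaH.comp (hpow 39) (mapsTo_pow_ball (by norm_num)))))
  have hcont' : ContinuousAt (fun q => n q * n (q ^ 4) * n (-q)) 0 :=
    ((hcont.mul (hcont.comp (hpow 4) (mapsTo_pow_ball four_ne_zero))).mul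
      (hcont.comp continuous_neg.continuousOn mapsTo_neg_ball)).continuousAt hball
  have h0 : n 0 * n (0 ^ 4) * n (-0) ≠ 0 := by simp [hn, thetaG_zero]
  filter_upwards [self_mem_nhdsWithin, mem_nhdsWithin_of_mem_nhds hball,
    mem_nhdsWithin_of_mem_nhds (hcont'.eventually_ne h0)] with q hq0 hq hnq
  rw [mem_ball_zero_iff] at hq
  have hq4 := pow_ne_zero 4 hq0
  have hq4' := norm_pow_lt_one hq four_ne_zero
  have hqn : -q ≠ 0 := neg_ne_zero.2 hq0
  have hqn' : ‖-q‖ < 1 := by rwa [norm_neg]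
  have hn₁ : n q ≠ 0 := fun h => hnq (by rw [h, zero_mul, zero_mul])
  have hn₂ : n (q ^ 4) ≠ 0 := fun h => hnq (by rw [h, mul_zero, zero_mul])
  have hn₃ : n (-q) ≠ 0 := fun h => hnq (by rw [h, mul_zero])
  have hU : ∀ {x : ℂ}, x ≠ 0 → ‖x‖ < 1 → n x = E x * E (x ^ 39) * U 1 39 x := fun h h' =>
    (E_mul_U_one_thirtynine h h').symm
  constructor
  · intro h
    have h₁ := psi_mul_form hq0 hq
    rw [h, mul_zero, ← hU hq0 hq, ← hU hq4 hq4'] at h₁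
    exact mul_ne_zero two_ne_zero (mul_ne_zero hn₁ hn₂) h₁.symm
  · intro h
    have h₁ := phi_mul_form' hq0 hq
    rw [h, mul_zero, ← E_mul_U_eq hq0 hq, ← E_mul_U_eq hqn hqn', ← hU hq0 hq, ← hU hqn hqn'] at h₁
    exact mul_ne_zero (mul_ne_zero two_ne_zero (pow_ne_zero 2 hq0)) (mul_ne_zero hn₁ hn₃) h₁.symm

end RogersRamanujan


end RogersRamanujanForms

theorem mainTheorem5 :
    (∀ q Q : ℂ, ‖q‖ < 1 → Q = q ^ 13 →
      2 * q ^ 2 * RogersRamanujanForms.E (q ^ 2) * RogersRamanujanForms.E (Q ^ 6)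
          * RogersRamanujanForms.U 1 39 q * RogersRamanujanForms.U 1 39 (-q)
        = RogersRamanujanForms.form 1 1 10 q + RogersRamanujanForms.form 2 1 5 q
          - RogersRamanujanForms.form 1 0 39 q - RogersRamanujanForms.form 5 2 8 q
      ∧
      2 * q ^ 2 * RogersRamanujanForms.E (q ^ 6) * RogersRamanujanForms.E (Q ^ 2)
          * RogersRamanujanForms.U 3 13 q * RogersRamanujanForms.U 3 13 (-q)
        = RogersRamanujanForms.form 3 0 13 q + RogersRamanujanForms.form 2 1 5 q
          - RogersRamanujanForms.form 3 3 4 q - RogersRamanujanForms.form 5 2 8 q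
      ∧
      RogersRamanujanForms.psi (-q ^ 3) * RogersRamanujanForms.psi (-Q) ≠ 0
      ∧
      (RogersRamanujanForms.form 1 0 39 q + RogersRamanujanForms.form 5 2 8 q ≠ 0 →
        (RogersRamanujanForms.form 3 0 13 q - RogersRamanujanForms.form 5 2 8 q)
            / (RogersRamanujanForms.form 1 0 39 q + RogersRamanujanForms.form 5 2 8 q)
          = q ^ 3 * ((RogersRamanujanForms.psi (-q) * RogersRamanujanForms.psi (-Q ^ 3))
            / (RogersRamanujanForms.psi (-q ^ 3) * RogersRamanujanForms.psi (-Q))))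
      ∧
      RogersRamanujanForms.phi (-q ^ 2) * RogersRamanujanForms.phi (-Q ^ 6) ≠ 0
      ∧
      (RogersRamanujanForms.form 3 0 13 q + RogersRamanujanForms.form 2 1 5 q
          - RogersRamanujanForms.form 3 3 4 q - RogersRamanujanForms.form 5 2 8 q ≠ 0 →
        (RogersRamanujanForms.form 1 1 10 q + RogersRamanujanForms.form 2 1 5 q
            - RogersRamanujanForms.form 1 0 39 q - RogersRamanujanForms.form 5 2 8 q)
            / (RogersRamanujanForms.form 3 0 13 q + RogersRamanujanForms.form 2 1 5 q
              - RogersRamanujanForms.form 3 3 4 q - RogersRamanujanForms.form 5 2 8 q)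
          = (RogersRamanujanForms.phi (-q ^ 6) * RogersRamanujanForms.phi (-Q ^ 2))
            / (RogersRamanujanForms.phi (-q ^ 2) * RogersRamanujanForms.phi (-Q ^ 6))))
    ∧ (∀ᶠ q : ℂ in 𝓝[≠] 0,
        RogersRamanujanForms.form 1 0 39 q + RogersRamanujanForms.form 5 2 8 q ≠ 0
        ∧ RogersRamanujanForms.form 3 0 13 q + RogersRamanujanForms.form 2 1 5 q
          - RogersRamanujanForms.form 3 3 4 q - RogersRamanujanForms.form 5 2 8 q ≠ 0) := by
  open RogersRamanujanForms in
  refine ⟨fun q Q hq hQ => ?_, eventually_forms_ne_zero⟩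
  subst hQ
  rcases eq_or_ne q 0 with rfl | hq0
  · have h₁ : form 1 1 10 0 = 1 := form_zero (by norm_num) (by norm_num)
    have h₂ : form 2 1 5 0 = 1 := form_zero (by norm_num) (by norm_num)
    have h₃ : form 1 0 39 0 = 1 := form_zero (by norm_num) (by norm_num)
    have h₄ : form 5 2 8 0 = 1 := form_zero (by norm_num) (by norm_num)
    have h₅ : form 3 0 13 0 = 1 := form_zero (by norm_num) (by norm_num)
    have h₆ : form 3 3 4 0 = 1 := form_zero (by norm_num) (by norm_num)
    rw [h₁, h₂, h₃, h₄, h₅, h₆]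
    norm_num [psi_zero, phi_zero]
  · have hN := E_mul_U_eq hq0 hq
    have hN₄ := E_mul_U_eq (pow_ne_zero 4 hq0) (norm_pow_lt_one hq four_ne_zero)
    have hN' := E_mul_U_eq (neg_ne_zero.2 hq0) (by rwa [norm_neg])
    have hψ : psi (-q ^ 3) * psi (-q ^ 13) ≠ 0 :=
      mul_ne_zero (psi_neg_ne_zero (pow_ne_zero 3 hq0) (norm_pow_lt_one hq (by norm_num)))
        (psi_neg_ne_zero (pow_ne_zero 13 hq0) (norm_pow_lt_one hq (by norm_num)))
    have hφ : phi (-q ^ 2) * phi (-q ^ 78) ≠ 0 := by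
      have h := phi_neg_sq_ne_zero (pow_ne_zero 39 hq0) (norm_pow_lt_one hq (by norm_num))
      rw [← pow_mul] at h
      exact mul_ne_zero (phi_neg_sq_ne_zero hq0 hq) h
    simp only [← pow_mul]
    norm_num only
    refine ⟨U_one_thirtynine_mul_neg hq0 hq, U_three_thirteen_mul_neg hq0 hq, hψ, fun h => ?_, hφ,
      fun h => ?_⟩
    · rw [← mul_div_assoc, div_eq_div_iff h hψ]
      have h₁ := psi_mul_form hq0 hq
      have h₂ := psi_mul_form' hq0 hq
      rw [hN, hN₄] at h₁
      linear_combination h₂ - q ^ 3 * h₁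
    · rw [div_eq_div_iff h hφ]
      have h₁ := phi_mul_form hq0 hq
      have h₂ := phi_mul_form' hq0 hq
      rw [hN, hN'] at h₁
      linear_combination h₁ - h₂
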